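/- **Setting.** Let $T$ be a locally compact Polish space, $\mathcal B_0(T)$ the family of its relatively compact Borel sets, $\sigma$ a Radon non-atomic measure on $T$ with $\sigma(O)>0$ for every non-empty open $O$, and $\lambda,\eta:T\to\mathbb R$ continuous with $\eta\ge 0$. Define measures $\gamma_n$ on $T^n$ by $\gamma_1=\sigma$ and $\gamma_{n+1}(ds,dt_1,\dots,dt_n)=\big(\sigma(ds)+\eta(t_1)\,\delta_{t_1}(ds)\big)\gamma_n(dt_1,\dots,dt_n)$, and let $\mathbb F=\mathbb R\oplus\bigoplus_{n\ge1}L^2(T^n,\gamma_n)$ (real Hilbert spaces). For a bounded measurable $f:T\to\mathbb R$ with compact support let $X(f)=X^+(f)+X^0(f)+X^-(f)$ be the bounded operator on $\mathbb F$ with $X^+(f)g=f\otimes g$, $(X^0(f)g)(t_1,\dots,t_n)=\lambda(t_1)f(t_1)g(t_1,\dots,t_n)$ for $n\ge 1$ (and $X^0(f)=0$ on $\mathbb R$), and $X^-(f)=X^+(f)^*$, that is, for $g\in L^2(T^{n+1},\gamma_{n+1})$, $$(X^-(f)g)(t_1,\dots,t_n)=\int_T f(s)g(s,t_1,\dots,t_n)\,\sigma(ds)+\eta(t_1)f(t_1)g(t_1,t_1,t_2,\dots,t_n),$$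 the last term being absent for $n=0$, and $X^-(f)=0$ on $\mathbb R$. This is the free Meixner process; put $M(\Delta)=X(\chi_\Delta)$ for $\Delta\in\mathcal B_0(T)$. For a real Hilbert space $\mathcal G$, let $\mathcal Z(T)$ be the set of all $Z:T\to\mathscr L(\mathcal G)$ that are uniform limits of simple mappings $\sum_i Z_i\chi_{\Delta_i}$ ($Z_i\in\mathscr L(\mathcal G)$, $\Delta_i\in\mathcal B_0(T)$) vanishing outside one common set of $\mathcal B_0(T)$, and let $\|Z\|_\infty=\sup_t\|Z(t)\|$. For $Z\in\mathcal Z(T)$, $\langle\omega,Z\rangle=\int_T Z\otimes dM\in\mathscr L(\mathcal G\otimes\mathbb F)$ is the norm limit of $\sum_i Z_i\otimes M(\Delta_i)$ (with disjoint $\Delta_i$) along such simple mappings. Operators on $\mathcal G$ are identified with operators $\,\cdot\otimes\mathbf 1$ on $\mathcal G\otimes\mathbb F$; integrals with respect to $\sigma$ are Bochner integrals. Operators $\langle P^{(n)}(\omega),Z_1\circledast\dots\circledast Z_n\rangle$ on $\mathcal G\otimes\mathbb F$ are defined recursively: the value is $\mathbf 1$ for $n=0$, it is $\langle\omega,Z_1\rangle$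 for $n=1$, and for $n\ge2$ $$\begin{aligned}\langle P^{(n)}(\omega),Z_1\circledast\dots\circledast Z_n\rangle={}&\langle\omega,Z_1\rangle\langle P^{(n-1)}(\omega),Z_2\circledast\dots\circledast Z_n\rangle-\langle P^{(n-1)}(\omega),(\lambda Z_1Z_2)\circledast Z_3\circledast\dots\circledast Z_n\rangle\\&-\int_T Z_1Z_2\,d\sigma\,\langle P^{(n-2)}(\omega),Z_3\circledast\dots\circledast Z_n\rangle\\&-[n-2]_0\,\langle P^{(n-2)}(\omega),(\eta Z_1Z_2Z_3)\circledast Z_4\circledast\dots\circledast Z_n\rangle,\end{aligned}$$ where $[0]_0=0$ and $[k]_0=1$ for $k\ge1$. The generating function is $G(Z,\omega)=\sum_{n\ge0}\langle P^{(n)}(\omega),Z^{\circledast n}\rangle$. For $l=1,2$, $\frac{Z^l}{1+\lambda Z+\eta Z^2}(t)$ denotes the Taylor series at $0$ of $x\mapsto x^l/(1+\lambda(t)x+\eta(t)x^2)$ evaluated at $x=Z(t)$. **Theorem.** For every $A\in\mathcal B_0(T)$ there is a constant $C_5(A)>0$ such that for every real Hilbert space $\mathcal G$ and every $Z\in\mathcal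 Z(T)$ that vanishes outside $A$ and satisfies $\|Z\|_\infty<C_5(A)$, the following holds. The Taylor series above converge absolutely and $\frac{Z^l}{1+\lambda Z+\eta Z^2}\in\mathcal Z(T)$ for $l=1,2$; the series for $G(Z,\omega)$ converges absolutely in operator norm; the inverses below exist as bounded operators; and $$G(Z,\omega)=\left(\mathbf 1-\Big\langle\omega,\frac{Z}{1+\lambda Z+\eta Z^2}\Big\rangle+\int_T\frac{Z(t)^2}{1+\lambda(t)Z(t)+\eta(t)Z(t)^2}\,\sigma(dt)\right)^{-1}.$$ Furthermore, with $\Psi_{\lambda,\eta}(Z)=\frac{Z}{1+\lambda Z+\eta Z^2}$ and $f(Z)=\left(\mathbf 1+\int_T\frac{Z(t)^2}{1+\lambda(t)Z(t)+\eta(t)Z(t)^2}\,\sigma(dt)\right)^{-1}$, $$G(Z,\omega)=\big(\mathbf 1-f(Z)\,\langle\omega,\Psi_{\lambda,\eta}(Z)\rangle\big)^{-1}f(Z).$$ -/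

import Mathlib

open MeasureTheory Filter Topology UniformSpace
open scoped ENNReal NNReal TensorProduct

set_option linter.unusedSectionVars false

noncomputable section

namespace FreeMeixner

variable {T : Type*} [TopologicalSpace T] [MeasurableSpace T]

/-- The class `𝓑₀(T)` of relatively compact Borel sets. -/
def IsBoundedBorel (A : Set T) : Prop := MeasurableSet A ∧ IsCompact (closure A)

/-- The space `B₀(T)` of bounded measurable functions `T → ℝ` with compact support. -/
structure BoundedTestFn (T : Type*) [TopologicalSpace T] [MeasurableSpace T] where
  toFun : T → ℝ
  measurable' : Measurable toFun
  bounded' : ∃ c : ℝ, ∀ t, |toFun t| ≤ c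
  compact' : HasCompactSupport toFun

/-- The indicator function `χ_A` of `A ∈ 𝓑₀(T)`. -/
def BoundedTestFn.indicator (A : Set T) (hA : IsBoundedBorel A) : BoundedTestFn T where
  toFun := A.indicator 1
  measurable' := measurable_one.indicator hA.1
  bounded' := ⟨1, fun t => by by_cases h : t ∈ A <;> simp [h]⟩
  compact' := by
    refine hA.2.of_isClosed_subset (isClosed_tsupport _) (closure_mono ?_)
    exact Set.support_indicator_subset

/-- The measures `γ_n` on `T^n`: `γ₀` is the unit mass on the one-point space `T⁰`, `γ₁ = σ`, and
`γ_{n+1}(ds, dt₁, …, dt_n) = (σ(ds) + η(t₁) δ_{t₁}(ds)) γ_n(dt₁, …, dt_n)` for `n ≥ 1`.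
Thus `γ_n` is the sum, over all ways to cut `(t₁, …, t_n)` into blocks of consecutive variables, of
the measures under which the variables in each block coincide and a block of `l` variables located
at `t` is distributed as `η(t)^(l-1) σ(dt)`. In particular `γ_n = σ^{⊗n}` if `η = 0`. -/
def fockMeasure (σ : Measure T) (η : C(T, ℝ)) : (n : ℕ) → Measure (Fin n → T)
  | 0 => Measure.dirac default
  | 1 => σ.map (fun s _ => s)
  | n + 2 =>
      (σ.prod (fockMeasure σ η (n + 1))).map
          (fun p : T × (Fin (n + 1) → T) => (Fin.cons p.1 p.2 : Fin (n + 2) → T))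
        + ((fockMeasure σ η (n + 1)).withDensity
            (fun t : Fin (n + 1) → T => ENNReal.ofReal (η (t 0)))).map
          (fun t : Fin (n + 1) → T => (Fin.cons (t 0) t : Fin (n + 2) → T))

theorem measurable_cons (n : ℕ) :
    Measurable (fun p : T × (Fin n → T) => (Fin.cons p.1 p.2 : Fin (n + 1) → T)) := by
  refine measurable_pi_iff.2 fun i => ?_
  refine Fin.cases ?_ (fun j => ?_) i
  · simpa using measurable_fst
  · simpa [Function.comp_def] using (measurable_pi_apply j).comp measurable_snd

theorem measurable_cons_diag (n : ℕ) :
    Measurable (fun t : Fin (n + 1) → T => (Fin.cons (t 0) t : Fin (n + 2) → T)) :=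
  (measurable_cons (n + 1)).comp ((measurable_pi_apply 0).prodMk measurable_id)

instance fockMeasure_sFinite (σ : Measure T) [SFinite σ] (η : C(T, ℝ)) (n : ℕ) :
    SFinite (fockMeasure σ η n) := by
  induction n using Nat.strong_induction_on with
  | _ n ih =>
    match n with
    | 0 => rw [fockMeasure]; infer_instance
    | 1 => rw [fockMeasure]; infer_instance
    | n + 2 =>
      have := ih (n + 1) (by omega)
      rw [fockMeasure]; infer_instance

theorem lintegral_fockMeasure_one (σ : Measure T) (η : C(T, ℝ)) {h : (Fin 1 → T) → ℝ≥0∞}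
    (hh : Measurable h) :
    ∫⁻ t, h t ∂(fockMeasure σ η 1) = ∫⁻ s, h (fun _ => s) ∂σ := by
  rw [fockMeasure, lintegral_map hh (measurable_pi_iff.2 fun _ => measurable_id')]

theorem lintegral_fockMeasure_succ [OpensMeasurableSpace T] (σ : Measure T) [SFinite σ]
    (η : C(T, ℝ)) (n : ℕ)
    {h : (Fin (n + 2) → T) → ℝ≥0∞} (hh : Measurable h) :
    ∫⁻ t, h t ∂(fockMeasure σ η (n + 2)) =
      ∫⁻ t, ((∫⁻ s, h (Fin.cons s t) ∂σ) + ENNReal.ofReal (η (t 0)) * h (Fin.cons (t 0) t))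
        ∂(fockMeasure σ η (n + 1)) := by
  have hη : Measurable (fun t : Fin (n + 1) → T => ENNReal.ofReal (η (t 0))) :=
    (η.continuous.measurable.comp (measurable_pi_apply 0)).ennreal_ofReal
  have h1 : Measurable (fun p : T × (Fin (n + 1) → T) => h (Fin.cons p.1 p.2)) :=
    hh.comp (measurable_cons (n + 1))
  have h2 : Measurable (fun t : Fin (n + 1) → T => h (Fin.cons (t 0) t)) :=
    hh.comp (measurable_cons_diag n)
  rw [fockMeasure, lintegral_add_measure, lintegral_map hh (measurable_cons (n + 1)),
    lintegral_map hh (measurable_cons_diag n), lintegral_prod_symm' _ h1,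
    lintegral_withDensity_eq_lintegral_mul _ hη h2, lintegral_add_left h1.lintegral_prod_left']
  rfl

/-! ### Weighted composition operators on `L²` -/

section WeightedComp

variable {X Y : Type*} [MeasurableSpace X] [MeasurableSpace Y] {μ : Measure X} {ν : Measure Y}

theorem eLpNorm_two_sq (f : X → ℝ) : eLpNorm f 2 μ ^ 2 = ∫⁻ z, ‖f z‖ₑ ^ 2 ∂μ := by
  have := eLpNorm_nnreal_pow_eq_lintegral (μ := μ) (f := f) (p := 2) (by norm_num)
  simpa using this

/-- The weighted composition `g ↦ m · (g ∘ φ)` is bounded by `K` from `L²(μ)` to `L²(ν)`. -/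
def HasWeightBound (μ : Measure X) (ν : Measure Y) (φ : Y → X) (m : Y → ℝ) (K : ℝ≥0) : Prop :=
  ∀ h : X → ℝ≥0∞, Measurable h →
    ∫⁻ y, ‖m y‖ₑ ^ 2 * h (φ y) ∂ν ≤ (K : ℝ≥0∞) ^ 2 * ∫⁻ x, h x ∂μ

theorem HasWeightBound.eLpNorm_le {φ : Y → X} {m : Y → ℝ} {K : ℝ≥0}
    (hK : HasWeightBound μ ν φ m K) (g : Lp ℝ 2 μ) :
    eLpNorm (fun y => m y * g (φ y)) 2 ν ≤ (K : ℝ≥0∞) * eLpNorm g 2 μ := by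
  have h0 := hK (fun x => ‖g x‖ₑ ^ 2) ((Lp.stronglyMeasurable g).measurable.enorm.pow_const 2)
  have : eLpNorm (fun y => m y * g (φ y)) 2 ν ^ 2 ≤ ((K : ℝ≥0∞) * eLpNorm g 2 μ) ^ 2 := by
    rw [mul_pow, eLpNorm_two_sq, eLpNorm_two_sq]
    simpa [enorm_mul, mul_pow] using h0
  exact (ENNReal.pow_le_pow_left_iff (by norm_num)).1 this

theorem HasWeightBound.memLp {φ : Y → X} {m : Y → ℝ} {K : ℝ≥0}
    (hK : HasWeightBound μ ν φ m K) (hm : Measurable m)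
    (hφ : Measure.QuasiMeasurePreserving φ ν μ) (g : Lp ℝ 2 μ) :
    MemLp (fun y => m y * g (φ y)) 2 ν :=
  ⟨hm.aestronglyMeasurable.mul
      ((Lp.aestronglyMeasurable g).comp_quasiMeasurePreserving hφ),
    (hK.eLpNorm_le g).trans_lt (ENNReal.mul_lt_top ENNReal.coe_lt_top (Lp.eLpNorm_lt_top g))⟩

/-- The operator `g ↦ m · (g ∘ φ)` from `L²(μ)` to `L²(ν)`. -/
def weightedComp (φ : Y → X) (m : Y → ℝ) (hm : Measurable m)
    (hφ : Measure.QuasiMeasurePreserving φ ν μ) (hK : ∃ K, HasWeightBound μ ν φ m K) :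
    Lp ℝ 2 μ →L[ℝ] Lp ℝ 2 ν :=
  LinearMap.mkContinuousOfExistsBound
    { toFun := fun g => (hK.choose_spec.memLp hm hφ g).toLp (fun y => m y * g (φ y))
      map_add' := fun g h => by
        rw [← MemLp.toLp_add]
        refine MemLp.toLp_congr _ _ ?_
        filter_upwards [hφ.ae (Lp.coeFn_add g h)] with y hy
        simp only [hy, Pi.add_apply]; ring
      map_smul' := fun c g => by
        rw [RingHom.id_apply, ← MemLp.toLp_const_smul]
        refine MemLp.toLp_congr _ _ ?_
        filter_upwards [hφ.ae (Lp.coeFn_smul c g)] with y hy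
        simp only [hy, Pi.smul_apply, smul_eq_mul]; ring }
    ⟨hK.choose, fun g => by
      simp only [LinearMap.coe_mk, AddHom.coe_mk, Lp.norm_toLp]
      rw [Lp.norm_def]
      refine (ENNReal.toReal_mono (ENNReal.mul_ne_top ENNReal.coe_ne_top (Lp.eLpNorm_ne_top g))
        (hK.choose_spec.eLpNorm_le g)).trans_eq ?_
      rw [ENNReal.toReal_mul, ENNReal.coe_toReal]⟩

theorem weightedComp_ae (φ : Y → X) (m : Y → ℝ) (hm : Measurable m)
    (hφ : Measure.QuasiMeasurePreserving φ ν μ) (hK : ∃ K, HasWeightBound μ ν φ m K)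
    (g : Lp ℝ 2 μ) : weightedComp φ m hm hφ hK g =ᵐ[ν] fun y => m y * g (φ y) :=
  MemLp.coeFn_toLp (hK.choose_spec.memLp hm hφ g)

theorem norm_weightedComp_le (φ : Y → X) (m : Y → ℝ) (hm : Measurable m)
    (hφ : Measure.QuasiMeasurePreserving φ ν μ) {K : ℝ≥0} (hK : HasWeightBound μ ν φ m K)
    (g : Lp ℝ 2 μ) : ‖weightedComp φ m hm hφ ⟨K, hK⟩ g‖ ≤ K * ‖g‖ := by
  rw [Lp.norm_def, eLpNorm_congr_ae (weightedComp_ae φ m hm hφ ⟨K, hK⟩ g), Lp.norm_def]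
  refine (ENNReal.toReal_mono (ENNReal.mul_ne_top ENNReal.coe_ne_top (Lp.eLpNorm_ne_top g))
    (hK.eLpNorm_le g)).trans_eq ?_
  rw [ENNReal.toReal_mul, ENNReal.coe_toReal]

end WeightedComp

/-! ### The measure-theoretic bounds behind the creation and neutral operators -/

section Levels

variable [BorelSpace T] (σ : Measure T) [SFinite σ] (lam η : C(T, ℝ))

theorem quasiMeasurePreserving_tail (n : ℕ) :
    Measure.QuasiMeasurePreserving (fun t : Fin (n + 1) → T => (Fin.tail t : Fin n → T))
      (fockMeasure σ η (n + 1)) (fockMeasure σ η n) := by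
  have hm : Measurable (fun t : Fin (n + 1) → T => (Fin.tail t : Fin n → T)) :=
    measurable_pi_iff.2 fun i => measurable_pi_apply _
  refine ⟨hm, Measure.AbsolutelyContinuous.mk fun s hs h0 => ?_⟩
  rw [Measure.map_apply hm hs]
  cases n with
  | zero =>
    have : s = ∅ := by
      by_contra hne
      obtain ⟨x, hx⟩ := Set.nonempty_iff_ne_empty.2 hne
      rw [fockMeasure, Measure.dirac_apply' _ hs, Set.indicator_of_mem] at h0
      · simp at h0
      · rwa [Subsingleton.elim default x]
    simp [this]
  | succ n =>
    rw [← lintegral_indicator_one (hm hs),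
      lintegral_fockMeasure_succ σ η n (measurable_one.indicator (hm hs)),
      lintegral_eq_zero_iff' ]
    · have : ∀ᵐ t ∂(fockMeasure σ η (n + 1)), t ∉ s := measure_eq_zero_iff_ae_notMem.1 h0
      filter_upwards [this] with t ht
      simp [Set.indicator, ht]
    · have hc : Measurable (fun p : T × (Fin (n + 1) → T) => (Set.indicator
          ((fun t : Fin (n + 2) → T => (Fin.tail t : Fin (n + 1) → T)) ⁻¹' s) 1
            (Fin.cons p.1 p.2 : Fin (n + 2) → T) : ℝ≥0∞)) :=
        (measurable_one.indicator (hm hs)).comp (measurable_cons (n + 1))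
      refine Measurable.aemeasurable (hc.lintegral_prod_left'.add (Measurable.mul ?_ ?_))
      · exact (η.continuous.measurable.comp (measurable_pi_apply 0)).ennreal_ofReal
      · exact (measurable_one.indicator (hm hs)).comp (measurable_cons_diag n)

theorem creation_bound {A : Set T} (hA : MeasurableSet A) {E S : ℝ≥0} (hS : σ A ≤ S)
    (hE : ∀ t ∈ A, η t ≤ E) {f : T → ℝ} (hf : Measurable f) {c : ℝ≥0}
    (hc : ∀ t, |f t| ≤ A.indicator (fun _ => (c : ℝ)) t) (n : ℕ) :
    HasWeightBound (fockMeasure σ η n) (fockMeasure σ η (n + 1)) Fin.tail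
      (fun t => f (t 0)) (c * NNReal.sqrt (S + E)) := by
  intro h hh
  have hff : ∀ t, ‖f t‖ₑ ^ 2 ≤ A.indicator (fun _ => (c : ℝ≥0∞) ^ 2) t := by
    intro t
    have h1 := hc t
    by_cases ht : t ∈ A
    · simp only [ht, Set.indicator_of_mem] at h1 ⊢
      gcongr
      rw [← ofReal_norm, Real.norm_eq_abs]
      simpa using ENNReal.ofReal_le_ofReal h1
    · simp only [ht, not_false_eq_true, Set.indicator_of_notMem] at h1 ⊢
      have : f t = 0 := abs_eq_zero.1 (le_antisymm h1 (abs_nonneg _))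
      simp [this]
  have hK : ((c * NNReal.sqrt (S + E) : ℝ≥0) : ℝ≥0∞) ^ 2
      = (c : ℝ≥0∞) ^ 2 * S + (c : ℝ≥0∞) ^ 2 * E := by
    norm_cast
    rw [mul_pow, NNReal.sq_sqrt, mul_add]
  have hint : ∫⁻ s, ‖f s‖ₑ ^ 2 ∂σ ≤ (c : ℝ≥0∞) ^ 2 * S := by
    refine (lintegral_mono hff).trans ?_
    rw [lintegral_indicator_const hA]
    gcongr
  have hfm : Measurable fun s => ‖f s‖ₑ ^ 2 := hf.enorm.pow_const 2
  have htm : Measurable (fun t : Fin (n + 1) → T => (Fin.tail t : Fin n → T)) :=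
    measurable_pi_iff.2 fun i => measurable_pi_apply _
  have hmeas : Measurable fun t : Fin (n + 1) → T => ‖f (t 0)‖ₑ ^ 2 * h (Fin.tail t) :=
    (hfm.comp (measurable_pi_apply 0)).mul (hh.comp htm)
  rw [hK]
  cases n with
  | zero =>
    rw [lintegral_fockMeasure_one σ η hmeas, fockMeasure, lintegral_dirac' _ hh]
    have : ∀ s : T, h (Fin.tail fun _ : Fin (0 + 1) => s) = h default := fun s => by
      congr 1; exact Subsingleton.elim _ _
    simp only [this]
    rw [lintegral_mul_const _ hfm]
    gcongr
    exact hint.trans le_self_add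
  | succ n =>
    rw [lintegral_fockMeasure_succ σ η n hmeas, ← lintegral_const_mul _ hh]
    refine lintegral_mono fun t => ?_
    simp only [Fin.cons_zero, Fin.tail_cons]
    rw [lintegral_mul_const _ hfm, add_mul, ← mul_assoc]
    refine add_le_add (by gcongr) (mul_le_mul_left ?_ _)
    have h1 := hff (t 0)
    by_cases ht : t 0 ∈ A
    · simp only [ht, Set.indicator_of_mem] at h1
      rw [mul_comm]
      refine mul_le_mul' h1 ?_
      simpa using ENNReal.ofReal_le_ofReal (hE _ ht)
    · simp only [ht, not_false_eq_true, Set.indicator_of_notMem] at h1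
      simp [le_antisymm h1 zero_le]

/-- The function `(t₁, …, t_n) ↦ λ(t₁) f(t₁)`, and `0` if `n = 0`. -/
def neutralWeight (f : T → ℝ) : (n : ℕ) → (Fin n → T) → ℝ
  | 0, _ => 0
  | _ + 1, t => lam (t 0) * f (t 0)

theorem measurable_neutralWeight {f : T → ℝ} (hf : Measurable f) (n : ℕ) :
    Measurable (neutralWeight lam f n) := by
  cases n with
  | zero => exact measurable_const
  | succ n =>
    exact (lam.continuous.measurable.mul hf).comp (measurable_pi_apply (0 : Fin (n + 1)))

theorem neutral_bound {A : Set T} {L : ℝ≥0}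
    (hL : ∀ t ∈ A, |lam t| ≤ L) {f : T → ℝ} {c : ℝ≥0}
    (hc : ∀ t, |f t| ≤ A.indicator (fun _ => (c : ℝ)) t) (n : ℕ) :
    HasWeightBound (fockMeasure σ η n) (fockMeasure σ η n) id
      (neutralWeight lam f n) (c * L) := by
  intro h hh
  rw [← lintegral_const_mul _ hh]
  refine lintegral_mono fun t => ?_
  simp only [id]
  gcongr
  rw [← ofReal_norm, Real.norm_eq_abs]
  have : |neutralWeight lam f n t| ≤ ((c * L : ℝ≥0) : ℝ) := by
    cases n with
    | zero => simp only [neutralWeight, abs_zero]; positivity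
    | succ n =>
      simp only [neutralWeight, abs_mul]
      have h1 := hc (t 0)
      by_cases ht : t 0 ∈ A
      · simp only [ht, Set.indicator_of_mem] at h1
        push_cast
        rw [mul_comm]
        exact mul_le_mul h1 (hL _ ht) (abs_nonneg _) c.2
      · simp only [ht, not_false_eq_true, Set.indicator_of_notMem] at h1
        rw [le_antisymm h1 (abs_nonneg _), mul_zero]; positivity
  simpa using ENNReal.ofReal_le_ofReal this

end Levels

section Operators

variable [BorelSpace T] (σ : Measure T) [SFinite σ] [IsFiniteMeasureOnCompacts σ]
  (lam η : C(T, ℝ))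

theorem exists_bounds {A : Set T} (hA : IsBoundedBorel A) :
    ∃ S E L : ℝ≥0, σ A ≤ S ∧ (∀ t ∈ A, η t ≤ E) ∧ ∀ t ∈ A, |lam t| ≤ L := by
  obtain ⟨e, he⟩ := hA.2.exists_bound_of_continuousOn η.continuous.continuousOn
  obtain ⟨l, hl⟩ := hA.2.exists_bound_of_continuousOn lam.continuous.continuousOn
  have hσ : σ A < ∞ := (measure_mono subset_closure).trans_lt hA.2.measure_lt_top
  refine ⟨(σ A).toNNReal, e.toNNReal, l.toNNReal, (ENNReal.coe_toNNReal hσ.ne).ge, ?_, ?_⟩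
  · exact fun t ht => (le_abs_self _).trans ((he t (subset_closure ht)).trans (Real.le_coe_toNNReal e))
  · exact fun t ht => (hl t (subset_closure ht)).trans (Real.le_coe_toNNReal l)

theorem BoundedTestFn.exists_le (f : BoundedTestFn T) :
    ∃ A : Set T, IsBoundedBorel A ∧ ∃ c : ℝ≥0,
      ∀ t, |f.toFun t| ≤ A.indicator (fun _ => (c : ℝ)) t := by
  obtain ⟨c, hc⟩ := f.bounded'
  refine ⟨tsupport f.toFun, ⟨(isClosed_tsupport _).measurableSet, ?_⟩, c.toNNReal, fun t => ?_⟩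
  · rw [(isClosed_tsupport _).closure_eq]; exact f.compact'
  · by_cases ht : t ∈ tsupport f.toFun
    · simp only [ht, Set.indicator_of_mem]
      exact (hc t).trans (Real.le_coe_toNNReal c)
    · simp [ht, image_eq_zero_of_notMem_tsupport ht]

end Operators

/-! ### Operators on a Hilbert direct sum -/

section Hilbert

variable {H : ℕ → Type*} [∀ n, NormedAddCommGroup (H n)] [∀ n, InnerProductSpace ℝ (H n)]

/-- The sequence `(0, C₀ F₀, C₁ F₁, …)`. -/
def raisingSeq (C : ∀ n, H n →L[ℝ] H (n + 1)) (F : ∀ n, H n) : ∀ n, H n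
  | 0 => 0
  | n + 1 => C n (F n)

theorem raisingSeq_hasSum {C : ∀ n, H n →L[ℝ] H (n + 1)} {K : ℝ} 
    (hC : ∀ n g, ‖C n g‖ ≤ K * ‖g‖) (F : lp H 2) :
    Summable (fun n => ‖raisingSeq C F n‖ ^ 2) ∧
      ∑' n, ‖raisingSeq C F n‖ ^ 2 ≤ K ^ 2 * ‖F‖ ^ 2 := by
  have hF : HasSum (fun n => ‖F n‖ ^ 2) (‖F‖ ^ 2) := by
    simpa using lp.hasSum_norm (p := 2) (by norm_num) F
  have hle : ∀ n, ‖raisingSeq C F (n + 1)‖ ^ 2 ≤ K ^ 2 * ‖F n‖ ^ 2 := fun n => by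
    rw [← mul_pow]; exact pow_le_pow_left₀ (norm_nonneg _) (hC n _) 2
  have hs : Summable (fun n => ‖raisingSeq C F (n + 1)‖ ^ 2) :=
    Summable.of_nonneg_of_le (fun _ => by positivity) hle (hF.summable.mul_left _)
  have hs' := (summable_nat_add_iff (f := fun n => ‖raisingSeq C F n‖ ^ 2) 1).1 hs
  refine ⟨hs', ?_⟩
  rw [hs'.tsum_eq_zero_add]
  simp only [raisingSeq, norm_zero, ne_eq, OfNat.ofNat_ne_zero, not_false_eq_true, zero_pow, zero_add]
  rw [← hF.tsum_eq, ← tsum_mul_left]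
  exact Summable.tsum_le_tsum hle hs (hF.summable.mul_left _)

theorem diag_hasSum {C : ∀ n, H n →L[ℝ] H n} {K : ℝ} 
    (hC : ∀ n g, ‖C n g‖ ≤ K * ‖g‖) (F : lp H 2) :
    Summable (fun n => ‖C n (F n)‖ ^ 2) ∧
      ∑' n, ‖C n (F n)‖ ^ 2 ≤ K ^ 2 * ‖F‖ ^ 2 := by
  have hF : HasSum (fun n => ‖F n‖ ^ 2) (‖F‖ ^ 2) := by
    simpa using lp.hasSum_norm (p := 2) (by norm_num) F
  have hle : ∀ n, ‖C n (F n)‖ ^ 2 ≤ K ^ 2 * ‖F n‖ ^ 2 := fun n => by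
    rw [← mul_pow]; exact pow_le_pow_left₀ (norm_nonneg _) (hC n _) 2
  have hs : Summable (fun n => ‖C n (F n)‖ ^ 2) :=
    Summable.of_nonneg_of_le (fun _ => by positivity) hle (hF.summable.mul_left _)
  refine ⟨hs, ?_⟩
  rw [← hF.tsum_eq, ← tsum_mul_left]
  exact Summable.tsum_le_tsum hle hs (hF.summable.mul_left _)

theorem norm_sq_eq (F : lp H 2) : ‖F‖ ^ 2 = ∑' n, ‖F n‖ ^ 2 := by
  simpa using lp.norm_rpow_eq_tsum (p := 2) (by norm_num) F

theorem memlp_of {u : ∀ n, H n} (h : Summable fun n => ‖u n‖ ^ 2) : Memℓp u 2 :=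
  memℓp_gen (by simpa using h)

/-- The operator `(F₀, F₁, …) ↦ (0, C₀ F₀, C₁ F₁, …)` on `⨁ H_n`. -/
def raisingOp (C : ∀ n, H n →L[ℝ] H (n + 1)) (hC : ∃ K : ℝ≥0, ∀ n g, ‖C n g‖ ≤ K * ‖g‖) :
    lp H 2 →L[ℝ] lp H 2 :=
  LinearMap.mkContinuousOfExistsBound
    { toFun := fun F => ⟨raisingSeq C F, memlp_of (raisingSeq_hasSum hC.choose_spec F).1⟩
      map_add' := fun F G => by
        ext1; funext n
        cases n
        · exact (add_zero (0 : H 0)).symm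
        · exact map_add (C _) _ _
      map_smul' := fun c F => by
        ext1; funext n; cases n <;> simp [raisingSeq] }
    ⟨hC.choose, fun F => by
      refine le_of_sq_le_sq ?_ (by positivity)
      rw [norm_sq_eq, mul_pow]
      exact (raisingSeq_hasSum hC.choose_spec F).2⟩

/-- The operator `(F₀, F₁, …) ↦ (C₀ F₀, C₁ F₁, …)` on `⨁ H_n`. -/
def diagOp (C : ∀ n, H n →L[ℝ] H n) (hC : ∃ K : ℝ≥0, ∀ n g, ‖C n g‖ ≤ K * ‖g‖) :
    lp H 2 →L[ℝ] lp H 2 :=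
  LinearMap.mkContinuousOfExistsBound
    { toFun := fun F => ⟨fun n => C n (F n), memlp_of (diag_hasSum hC.choose_spec F).1⟩
      map_add' := fun F G => by
        ext1; funext n; exact map_add (C n) _ _
      map_smul' := fun c F => by
        ext1; funext n; simp }
    ⟨hC.choose, fun F => by
      refine le_of_sq_le_sq ?_ (by positivity)
      rw [norm_sq_eq, mul_pow]
      exact (diag_hasSum hC.choose_spec F).2⟩

end Hilbert


/-! ### The free Meixner process on the extended Fock space -/

section Fock

variable [BorelSpace T] (σ : Measure T) [SFinite σ] [IsFiniteMeasureOnCompacts σ]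
  (lam η : C(T, ℝ))

/-- The extended Fock space `𝔽 = ⨁_{n ≥ 0} L²(T^n, γ_n)`; the summand for `n = 0` is `ℝ`. -/
abbrev ExtFock : Type _ := lp (fun n => Lp ℝ 2 (fockMeasure σ η n)) 2

theorem creation_hasBound (f : BoundedTestFn T) : ∃ K : ℝ≥0, ∀ n,
    HasWeightBound (fockMeasure σ η n) (fockMeasure σ η (n + 1)) Fin.tail
      (fun t => f.toFun (t 0)) K := by
  obtain ⟨A, hA, c, hc⟩ := f.exists_le
  obtain ⟨S, E, L, hS, hE, hL⟩ := exists_bounds σ η η hA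
  exact ⟨_, fun n => creation_bound σ η hA.1 hS hE f.measurable' hc n⟩

theorem neutral_hasBound (f : BoundedTestFn T) : ∃ K : ℝ≥0, ∀ n,
    HasWeightBound (fockMeasure σ η n) (fockMeasure σ η n) id
      (neutralWeight lam f.toFun n) K := by
  obtain ⟨A, hA, c, hc⟩ := f.exists_le
  obtain ⟨S, E, L, hS, hE, hL⟩ := exists_bounds σ lam η hA
  exact ⟨_, fun n => neutral_bound σ lam η hL hc n⟩

/-- `g ↦ f ⊗ g`, i.e. `(t₁, …, t_{n+1}) ↦ f(t₁) g(t₂, …, t_{n+1})`. -/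
def creationLevel (f : BoundedTestFn T) (n : ℕ) :
    Lp ℝ 2 (fockMeasure σ η n) →L[ℝ] Lp ℝ 2 (fockMeasure σ η (n + 1)) :=
  weightedComp Fin.tail (fun t => f.toFun (t 0)) (f.measurable'.comp (measurable_pi_apply 0))
    (quasiMeasurePreserving_tail σ η n)
    ⟨(creation_hasBound σ η f).choose, (creation_hasBound σ η f).choose_spec n⟩

/-- `g ↦ λ(t₁) f(t₁) g(t₁, …, t_n)`, and `0` for `n = 0`. -/
def neutralLevel (f : BoundedTestFn T) (n : ℕ) :
    Lp ℝ 2 (fockMeasure σ η n) →L[ℝ] Lp ℝ 2 (fockMeasure σ η n) :=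
  weightedComp id (neutralWeight lam f.toFun n) (measurable_neutralWeight lam f.measurable' n)
    (Measure.QuasiMeasurePreserving.id _)
    ⟨(neutral_hasBound σ lam η f).choose, (neutral_hasBound σ lam η f).choose_spec n⟩

theorem creationLevel_ae (f : BoundedTestFn T) (n : ℕ) (g : Lp ℝ 2 (fockMeasure σ η n)) :
    creationLevel σ η f n g =ᵐ[fockMeasure σ η (n + 1)]
      fun t => f.toFun (t 0) * g (Fin.tail t) :=
  weightedComp_ae _ _ _ _ _ _

theorem neutralLevel_ae (f : BoundedTestFn T) (n : ℕ) (g : Lp ℝ 2 (fockMeasure σ η n)) :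
    neutralLevel σ lam η f n g =ᵐ[fockMeasure σ η n]
      fun t => neutralWeight lam f.toFun n t * g t :=
  weightedComp_ae _ _ _ _ _ _

/-- The creation operator `X⁺(f)`. -/
def creation (f : BoundedTestFn T) : ExtFock σ η →L[ℝ] ExtFock σ η :=
  raisingOp (creationLevel σ η f)
    ⟨(creation_hasBound σ η f).choose, fun n g => norm_weightedComp_le _ _ _ _
      ((creation_hasBound σ η f).choose_spec n) g⟩

/-- The neutral operator `X⁰(f)`. -/
def neutral (f : BoundedTestFn T) : ExtFock σ η →L[ℝ] ExtFock σ η :=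
  diagOp (neutralLevel σ lam η f)
    ⟨(neutral_hasBound σ lam η f).choose, fun n g => norm_weightedComp_le _ _ _ _
      ((neutral_hasBound σ lam η f).choose_spec n) g⟩

/-- The extended annihilation operator `X⁻(f)`, the adjoint of `X⁺(f)`. Explicitly
`(X⁻(f) F)(t₁, …, t_n) = ∫ f(s) F(s, t₁, …, t_n) σ(ds) + η(t₁) f(t₁) F(t₁, t₁, t₂, …, t_n)`,
where the last term is absent for `n = 0`; see `inner_annihilation` and
`inner_annihilation_zero` below. -/
def annihilation (f : BoundedTestFn T) : ExtFock σ η →L[ℝ] ExtFock σ η :=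
  ContinuousLinearMap.adjoint (creation σ η f)

/-- The free Meixner process `X(f) = ⟨ω, f⟩ = X⁺(f) + X⁰(f) + X⁻(f)`. -/
def process (f : BoundedTestFn T) : ExtFock σ η →L[ℝ] ExtFock σ η :=
  creation σ η f + neutral σ lam η f + annihilation σ η f

open Classical in
/-- The operator-valued measure `M(Δ) = X(χ_Δ)`, `Δ ∈ 𝓑₀(T)`. -/
def processMeasure (Δ : Set T) : ExtFock σ η →L[ℝ] ExtFock σ η :=
  if h : IsBoundedBorel Δ then process σ lam η (.indicator Δ h) else 0

theorem integral_fockMeasure_succ (hη : ∀ t, 0 ≤ η t) (n : ℕ) {h : (Fin (n + 2) → T) → ℝ}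
    (hh : Integrable h (fockMeasure σ η (n + 2))) :
    ∫ t, h t ∂(fockMeasure σ η (n + 2)) =
      ∫ t, ((∫ s, h (Fin.cons s t) ∂σ) + η (t 0) * h (Fin.cons (t 0) t))
        ∂(fockMeasure σ η (n + 1)) := by
  have hηm : Measurable (fun t : Fin (n + 1) → T => (η (t 0)).toNNReal) :=
    (η.continuous.measurable.comp (measurable_pi_apply 0)).real_toNNReal
  rw [fockMeasure] at hh ⊢
  obtain ⟨h1, h2⟩ := integrable_add_measure.1 hh
  rw [integral_add_measure h1 h2, integral_map (measurable_cons (n + 1)).aemeasurable h1.1,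
    integral_map (measurable_cons_diag n).aemeasurable h2.1]
  have h1' : Integrable (fun p : T × (Fin (n + 1) → T) => h (Fin.cons p.1 p.2))
      (σ.prod (fockMeasure σ η (n + 1))) := h1.comp_measurable (measurable_cons (n + 1))
  have h2' : Integrable (fun t : Fin (n + 1) → T => h (Fin.cons (t 0) t))
      ((fockMeasure σ η (n + 1)).withDensity fun t => ((η (t 0)).toNNReal : ℝ≥0∞)) :=
    h2.comp_measurable (measurable_cons_diag n)
  have e := integral_withDensity_eq_integral_smul hηm (μ := fockMeasure σ η (n + 1))
    (fun t : Fin (n + 1) → T => h (Fin.cons (t 0) t))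
  have h2'' := (integrable_withDensity_iff_integrable_smul hηm).1 h2'
  rw [integral_prod_symm _ h1', integral_add h1'.integral_prod_right]
  · congr 1
    refine e.trans (integral_congr_ae (Eventually.of_forall fun t => ?_))
    simp [NNReal.smul_def, Real.coe_toNNReal _ (hη _)]
  · refine h2''.congr (Eventually.of_forall fun t => ?_)
    simp [NNReal.smul_def, Real.coe_toNNReal _ (hη _)]

theorem inner_annihilation (hη : ∀ t, 0 ≤ η t) (f : BoundedTestFn T) (F : ExtFock σ η) (n : ℕ)
    (h : Lp ℝ 2 (fockMeasure σ η (n + 1))) :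
    inner ℝ (annihilation σ η f F (n + 1)) h =
      ∫ t, ((∫ s, f.toFun s * F (n + 2) (Fin.cons s t) ∂σ)
          + η (t 0) * f.toFun (t 0) * F (n + 2) (Fin.cons (t 0) t)) * h t
        ∂(fockMeasure σ η (n + 1)) := by
  classical
  have h1 : inner ℝ (annihilation σ η f F (n + 1)) h
      = inner ℝ (F (n + 2)) (creationLevel σ η f (n + 1) h) := by
    rw [← lp.inner_single_right (G := fun n => Lp ℝ 2 (fockMeasure σ η n)), annihilation,
      ContinuousLinearMap.adjoint_inner_left, lp.inner_eq_tsum, tsum_eq_single (n + 2)]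
    · change inner ℝ (F (n + 2)) (creationLevel σ η f (n + 1)
        (lp.single (E := fun n => Lp ℝ 2 (fockMeasure σ η n)) 2 (n + 1) h (n + 1))) = _
      rw [lp.single_apply_self]
    · intro m hm
      cases m with
      | zero => exact inner_zero_right _
      | succ m =>
        change inner ℝ (F (m + 1)) (creationLevel σ η f m
          (lp.single (E := fun n => Lp ℝ 2 (fockMeasure σ η n)) 2 (n + 1) h m)) = 0
        rw [lp.single_apply_ne _ _ _ (by omega), map_zero, inner_zero_right]
  rw [h1, L2.inner_def]
  have h2 : (fun t => inner ℝ (F (n + 2) t) (creationLevel σ η f (n + 1) h t))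
      =ᵐ[fockMeasure σ η (n + 2)] fun t => f.toFun (t 0) * F (n + 2) t * h (Fin.tail t) := by
    filter_upwards [creationLevel_ae σ η f (n + 1) h] with t ht
    rw [ht]; simp only [RCLike.inner_apply, conj_trivial]; ring
  have hint : Integrable (fun t => f.toFun (t 0) * F (n + 2) t * h (Fin.tail t))
      (fockMeasure σ η (n + 2)) := (L2.integrable_inner _ _).congr h2
  rw [integral_congr_ae h2, integral_fockMeasure_succ σ η hη n hint]
  refine integral_congr_ae (Eventually.of_forall fun t => ?_)
  simp only [Fin.cons_zero, Fin.tail_cons]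
  rw [integral_mul_const]
  ring

theorem inner_annihilation_zero (f : BoundedTestFn T) (F : ExtFock σ η)
    (h : Lp ℝ 2 (fockMeasure σ η 0)) :
    inner ℝ (annihilation σ η f F 0) h =
      (∫ s, f.toFun s * F 1 (fun _ => s) ∂σ) * h default := by
  classical
  have h1 : inner ℝ (annihilation σ η f F 0) h = inner ℝ (F 1) (creationLevel σ η f 0 h) := by
    rw [← lp.inner_single_right (G := fun n => Lp ℝ 2 (fockMeasure σ η n)), annihilation,
      ContinuousLinearMap.adjoint_inner_left, lp.inner_eq_tsum, tsum_eq_single 1]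
    · change inner ℝ (F 1) (creationLevel σ η f 0
        (lp.single (E := fun n => Lp ℝ 2 (fockMeasure σ η n)) 2 0 h 0)) = _
      rw [lp.single_apply_self]
    · intro m hm
      cases m with
      | zero => exact inner_zero_right _
      | succ m =>
        change inner ℝ (F (m + 1)) (creationLevel σ η f m
          (lp.single (E := fun n => Lp ℝ 2 (fockMeasure σ η n)) 2 0 h m)) = 0
        rw [lp.single_apply_ne _ _ _ (by omega), map_zero, inner_zero_right]
  rw [h1, L2.inner_def]
  have h2 : (fun t => inner ℝ (F 1 t) (creationLevel σ η f 0 h t))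
      =ᵐ[fockMeasure σ η 1] fun t => f.toFun (t 0) * F 1 t * h default := by
    filter_upwards [creationLevel_ae σ η f 0 h] with t ht
    rw [ht, Subsingleton.elim (Fin.tail t) default]
    simp only [RCLike.inner_apply, conj_trivial]; ring
  have hm : Measurable (fun (s : T) (_ : Fin 1) => s) := measurable_pi_iff.2 fun _ => measurable_id
  rw [integral_congr_ae h2, integral_mul_const]
  have key : fockMeasure σ η 1 = σ.map fun (s : T) (_ : Fin 1) => s := by rw [fockMeasure]
  have gen : ∀ φ : (Fin 1 → T) → ℝ, AEStronglyMeasurable φ (fockMeasure σ η 1) →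
      ∫ t, φ t ∂(fockMeasure σ η 1) = ∫ s, φ (fun _ => s) ∂σ := fun φ hφ => by
    rw [key] at hφ ⊢
    exact integral_map hm.aemeasurable hφ
  congr 1
  exact gen _ ((f.measurable'.comp (measurable_pi_apply (0 : Fin 1))).aestronglyMeasurable.mul
    (Lp.aestronglyMeasurable (F 1)))

theorem norm_creation_le {f : BoundedTestFn T} {A : Set T} (hA : MeasurableSet A) {E S : ℝ≥0}
    (hS : σ A ≤ S) (hE : ∀ t ∈ A, η t ≤ E) {c : ℝ≥0}
    (hc : ∀ t, |f.toFun t| ≤ A.indicator (fun _ => (c : ℝ)) t) :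
    ‖creation σ η f‖ ≤ (c * NNReal.sqrt (S + E) : ℝ≥0) := by
  refine ContinuousLinearMap.opNorm_le_bound _ (NNReal.coe_nonneg _) fun F => ?_
  refine le_of_sq_le_sq ?_ (by positivity)
  rw [norm_sq_eq, mul_pow]
  exact (raisingSeq_hasSum (fun n g => norm_weightedComp_le _ _ _ _
    (creation_bound σ η hA hS hE f.measurable' hc n) g) F).2

theorem norm_neutral_le {f : BoundedTestFn T} {A : Set T} {L : ℝ≥0}
    (hL : ∀ t ∈ A, |lam t| ≤ L) {c : ℝ≥0}
    (hc : ∀ t, |f.toFun t| ≤ A.indicator (fun _ => (c : ℝ)) t) :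
    ‖neutral σ lam η f‖ ≤ (c * L : ℝ≥0) := by
  refine ContinuousLinearMap.opNorm_le_bound _ (NNReal.coe_nonneg _) fun F => ?_
  refine le_of_sq_le_sq ?_ (by positivity)
  rw [norm_sq_eq, mul_pow]
  exact (diag_hasSum (fun n g => norm_weightedComp_le _ _ _ _
    (neutral_bound σ lam η hL hc n) g) F).2

theorem creation_add {f g h : BoundedTestFn T} (hfg : ∀ t, h.toFun t = f.toFun t + g.toFun t) :
    creation σ η h = creation σ η f + creation σ η g := by
  refine ContinuousLinearMap.ext fun F => ?_
  ext1; funext n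
  cases n with
  | zero => exact (add_zero (0 : Lp ℝ 2 (fockMeasure σ η 0))).symm
  | succ n =>
    change creationLevel σ η h n (F n) = creationLevel σ η f n (F n) + creationLevel σ η g n (F n)
    refine Lp.ext ?_
    filter_upwards [Lp.coeFn_add (creationLevel σ η f n (F n)) (creationLevel σ η g n (F n)),
      creationLevel_ae σ η h n (F n), creationLevel_ae σ η f n (F n),
      creationLevel_ae σ η g n (F n)] with t h1 h2 h3 h4
    rw [h1, Pi.add_apply, h2, h3, h4, hfg]; ring

theorem neutral_add {f g h : BoundedTestFn T} (hfg : ∀ t, h.toFun t = f.toFun t + g.toFun t) :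
    neutral σ lam η h = neutral σ lam η f + neutral σ lam η g := by
  refine ContinuousLinearMap.ext fun F => ?_
  ext1; funext n
  change neutralLevel σ lam η h n (F n) =
    neutralLevel σ lam η f n (F n) + neutralLevel σ lam η g n (F n)
  refine Lp.ext ?_
  filter_upwards [Lp.coeFn_add (neutralLevel σ lam η f n (F n)) (neutralLevel σ lam η g n (F n)),
    neutralLevel_ae σ lam η h n (F n), neutralLevel_ae σ lam η f n (F n),
    neutralLevel_ae σ lam η g n (F n)] with t h1 h2 h3 h4
  rw [h1, Pi.add_apply, h2, h3, h4]
  cases n with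
  | zero => simp [neutralWeight]
  | succ n => simp only [neutralWeight, hfg]; ring

theorem inner_creation_eq_zero {f g : BoundedTestFn T} (hfg : ∀ t, f.toFun t * g.toFun t = 0)
    (F G : ExtFock σ η) : inner ℝ (creation σ η f F) (creation σ η g G) = 0 := by
  rw [lp.inner_eq_tsum]
  refine (tsum_congr fun n => ?_).trans tsum_zero
  cases n with
  | zero => exact inner_zero_left _
  | succ n =>
    change inner ℝ (creationLevel σ η f n (F n)) (creationLevel σ η g n (G n)) = 0
    rw [L2.inner_def]
    refine integral_eq_zero_of_ae ?_
    filter_upwards [creationLevel_ae σ η f n (F n), creationLevel_ae σ η g n (G n)] with t h3 h4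
    rw [h3, h4]
    simp only [RCLike.inner_apply, conj_trivial, Pi.zero_apply]
    linear_combination (F n (Fin.tail t) * G n (Fin.tail t)) * hfg (t 0)

theorem inner_neutral_eq_zero {f g : BoundedTestFn T} (hfg : ∀ t, f.toFun t * g.toFun t = 0)
    (F G : ExtFock σ η) : inner ℝ (neutral σ lam η f F) (neutral σ lam η g G) = 0 := by
  rw [lp.inner_eq_tsum]
  refine (tsum_congr fun n => ?_).trans tsum_zero
  change inner ℝ (neutralLevel σ lam η f n (F n)) (neutralLevel σ lam η g n (G n)) = 0
  rw [L2.inner_def]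
  refine integral_eq_zero_of_ae ?_
  filter_upwards [neutralLevel_ae σ lam η f n (F n), neutralLevel_ae σ lam η g n (G n)]
    with t h3 h4
  rw [h3, h4]
  cases n with
  | zero => simp [neutralWeight]
  | succ n =>
    simp only [RCLike.inner_apply, conj_trivial, Pi.zero_apply, neutralWeight]
    linear_combination (lam (t 0) ^ 2 * F (n + 1) t * G (n + 1) t) * hfg (t 0)

end Fock


/-! ### Integrals of operator-valued functions against operator-valued measures -/

section OperatorIntegral

variable {𝒢 : Type*} [NormedAddCommGroup 𝒢] [InnerProductSpace ℝ 𝒢]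
  {ℋ : Type*} [NormedAddCommGroup ℋ] [InnerProductSpace ℝ ℋ]

variable (𝒢 ℋ) in
/-- The Hilbert space tensor product `𝒢 ⊗ ℋ`. -/
def HilbertTensor : Type _ := Completion (𝒢 ⊗[ℝ] ℋ)

instance : NormedAddCommGroup (HilbertTensor 𝒢 ℋ) :=
  inferInstanceAs (NormedAddCommGroup (Completion (𝒢 ⊗[ℝ] ℋ)))

instance : InnerProductSpace ℝ (HilbertTensor 𝒢 ℋ) :=
  inferInstanceAs (InnerProductSpace ℝ (Completion (𝒢 ⊗[ℝ] ℋ)))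

instance : CompleteSpace (HilbertTensor 𝒢 ℋ) :=
  inferInstanceAs (CompleteSpace (Completion (𝒢 ⊗[ℝ] ℋ)))

/-- The embedding of the algebraic tensor product. -/
def toTensor : (𝒢 ⊗[ℝ] ℋ) →ₗᵢ[ℝ] HilbertTensor 𝒢 ℋ := Completion.toComplₗᵢ

/-- The bounded operator `x ⊗ m` on `𝒢 ⊗ ℋ`. -/
def opTensor (x : 𝒢 →L[ℝ] 𝒢) (m : ℋ →L[ℝ] ℋ) : HilbertTensor 𝒢 ℋ →L[ℝ] HilbertTensor 𝒢 ℋ :=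
  (TensorProduct.mapL x m).completion

theorem opTensor_coe (x : 𝒢 →L[ℝ] 𝒢) (m : ℋ →L[ℝ] ℋ) (u : 𝒢 ⊗[ℝ] ℋ) :
    opTensor x m (toTensor u) = toTensor (TensorProduct.mapL x m u) :=
  ContinuousLinearMap.completion_apply_coe _ _

theorem clm_completion_ext {P Q : HilbertTensor 𝒢 ℋ →L[ℝ] HilbertTensor 𝒢 ℋ}
    (h : ∀ u : 𝒢 ⊗[ℝ] ℋ, P (toTensor u) = Q (toTensor u)) : P = Q := by
  ext v
  induction v using Completion.induction_on with
  | hp => exact isClosed_eq P.continuous Q.continuous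
  | ih u => exact h u

theorem opTensor_add_left (x y : 𝒢 →L[ℝ] 𝒢) (m : ℋ →L[ℝ] ℋ) :
    opTensor (x + y) m = opTensor x m + opTensor y m := by
  refine clm_completion_ext fun u => ?_
  simp only [add_apply, opTensor_coe, TensorProduct.mapL_add_left,
    map_add]

theorem opTensor_add_right (x : 𝒢 →L[ℝ] 𝒢) (m m' : ℋ →L[ℝ] ℋ) :
    opTensor x (m + m') = opTensor x m + opTensor x m' := by
  refine clm_completion_ext fun u => ?_
  simp only [add_apply, opTensor_coe, TensorProduct.mapL_add_right,
    map_add]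

theorem opTensor_zero_left (m : ℋ →L[ℝ] ℋ) : opTensor (0 : 𝒢 →L[ℝ] 𝒢) m = 0 := by
  have := opTensor_add_left (0 : 𝒢 →L[ℝ] 𝒢) 0 m
  simpa using this

theorem opTensor_sub_left (x y : 𝒢 →L[ℝ] 𝒢) (m : ℋ →L[ℝ] ℋ) :
    opTensor (x - y) m = opTensor x m - opTensor y m := by
  rw [eq_sub_iff_add_eq, ← opTensor_add_left, sub_add_cancel]

/-- `∫ S ⊗ dM = ∑ Sᵢ ⊗ M(Δᵢ)` for a simple mapping `S = ∑ Sᵢ χ_{Δᵢ}` (with `Δᵢ` the level sets). -/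
def simpleOpIntegral (M : Set T → ℋ →L[ℝ] ℋ) (S : SimpleFunc T (𝒢 →L[ℝ] 𝒢)) :
    HilbertTensor 𝒢 ℋ →L[ℝ] HilbertTensor 𝒢 ℋ :=
  ∑ x ∈ S.range, opTensor x (M (S ⁻¹' {x}))

/-- `Q = ∫ Z ⊗ dM`: the norm limit of the integrals of simple mappings that vanish outside one
relatively compact Borel set and converge uniformly to `Z`. -/
def IsOpIntegral (M : Set T → ℋ →L[ℝ] ℋ) (Z : T → 𝒢 →L[ℝ] 𝒢)
    (Q : HilbertTensor 𝒢 ℋ →L[ℝ] HilbertTensor 𝒢 ℋ) : Prop :=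
  ∃ A : Set T, IsBoundedBorel A ∧ ∃ S : ℕ → SimpleFunc T (𝒢 →L[ℝ] 𝒢),
    (∀ n, Function.support (S n) ⊆ A) ∧ TendstoUniformly (fun n t => S n t) Z atTop ∧
      Tendsto (fun n => simpleOpIntegral M (S n)) atTop (𝓝 Q)

/-! The integral is well defined for the process at hand; this is `existsUnique_isOpIntegral`. -/

theorem opNorm_completion_le
    {P : HilbertTensor 𝒢 ℋ →L[ℝ] HilbertTensor 𝒢 ℋ} {K : ℝ} (hK : 0 ≤ K)
    (h : ∀ u : 𝒢 ⊗[ℝ] ℋ, ‖P (toTensor u)‖ ≤ K * ‖u‖) :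
    ‖P‖ ≤ K := by
  refine P.opNorm_le_bound hK fun v => ?_
  induction v using Completion.induction_on with
  | hp => exact isClosed_le P.continuous.norm (continuous_const.mul continuous_norm)
  | ih u => exact (h u).trans_eq (by rw [← Completion.norm_coe u]; rfl)

theorem norm_opTensor_le (x : 𝒢 →L[ℝ] 𝒢) (m : ℋ →L[ℝ] ℋ) : ‖opTensor x m‖ ≤ ‖x‖ * ‖m‖ := by
  refine opNorm_completion_le (by positivity) fun u => ?_
  rw [opTensor_coe, toTensor.norm_map]
  exact (ContinuousLinearMap.le_opNorm _ _).trans (by gcongr; exact TensorProduct.norm_mapL_le _ _)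

theorem opTensor_smul_left (r : ℝ) (x : 𝒢 →L[ℝ] 𝒢) (m : ℋ →L[ℝ] ℋ) :
    opTensor (r • x) m = r • opTensor x m := by
  refine clm_completion_ext fun u => ?_
  simp only [smul_apply, opTensor_coe, TensorProduct.mapL_smul_left, map_smul]

variable (𝒢) in
/-- `x ↦ x ⊗ m` as a bounded linear map. -/
def opTensorL (m : ℋ →L[ℝ] ℋ) :
    (𝒢 →L[ℝ] 𝒢) →L[ℝ] (HilbertTensor 𝒢 ℋ →L[ℝ] HilbertTensor 𝒢 ℋ) :=
  LinearMap.mkContinuous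
    { toFun := fun x => opTensor x m
      map_add' := fun x y => opTensor_add_left x y m
      map_smul' := fun r x => opTensor_smul_left r x m } ‖m‖
    fun x => (norm_opTensor_le x m).trans_eq (mul_comm _ _)


theorem inner_mapL_eq_zero {x y : 𝒢 →L[ℝ] 𝒢} {U V : ℋ →L[ℝ] ℋ}
    (h : ∀ F G, inner ℝ (U F) (V G) = 0) (u v : 𝒢 ⊗[ℝ] ℋ) :
    inner ℝ (TensorProduct.mapL x U u) (TensorProduct.mapL y V v) = 0 := by
  induction u with
  | zero => simp
  | add a b ha hb => rw [map_add, inner_add_left, ha, hb, add_zero]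
  | tmul a b =>
    induction v with
    | zero => simp
    | add a b ha hb => rw [map_add, inner_add_right, ha, hb, add_zero]
    | tmul c d => simp [TensorProduct.inner_tmul, h]

theorem norm_sum_sq {ι : Type*} (s : Finset ι) {E : Type*} [NormedAddCommGroup E]
    [InnerProductSpace ℝ E] (v : ι → E) (h : ∀ i ∈ s, ∀ j ∈ s, i ≠ j → inner ℝ (v i) (v j) = 0) :
    ‖∑ i ∈ s, v i‖ ^ 2 = ∑ i ∈ s, ‖v i‖ ^ 2 := by
  rw [← real_inner_self_eq_norm_sq, sum_inner]
  refine Finset.sum_congr rfl fun i hi => ?_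
  rw [inner_sum, Finset.sum_eq_single_of_mem i hi fun j hj hji => h i hi j hj hji.symm,
    real_inner_self_eq_norm_sq]

theorem norm_sum_mapL_le {ι : Type*} (s : Finset ι) (x : ι → 𝒢 →L[ℝ] 𝒢) (U : ι → ℋ →L[ℝ] ℋ)
    (h : ∀ i ∈ s, ∀ j ∈ s, i ≠ j → ∀ F G, inner ℝ (U i F) (U j G) = 0) {c C : ℝ} (hc : 0 ≤ c)
    (hx : ∀ i ∈ s, ‖x i‖ ≤ c) (hC : ‖∑ i ∈ s, U i‖ ≤ C) (u : 𝒢 ⊗[ℝ] ℋ) :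
    ‖∑ i ∈ s, TensorProduct.mapL (x i) (U i) u‖ ≤ c * C * ‖u‖ := by
  have hC0 : 0 ≤ C := (norm_nonneg _).trans hC
  refine le_of_sq_le_sq ?_ (by positivity)
  rw [norm_sum_sq s _ fun i hi j hj hij => inner_mapL_eq_zero (h i hi j hj hij) u u]
  have h1 : ∀ i ∈ s, ‖TensorProduct.mapL (x i) (U i) u‖ ^ 2
      ≤ c ^ 2 * ‖TensorProduct.mapL (1 : 𝒢 →L[ℝ] 𝒢) (U i) u‖ ^ 2 := fun i hi => by
    have : TensorProduct.mapL (x i) (U i) u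
        = TensorProduct.mapL (x i) (1 : ℋ →L[ℝ] ℋ)
          (TensorProduct.mapL (1 : 𝒢 →L[ℝ] 𝒢) (U i) u) := by
      rw [← mul_apply_eq_comp, ← TensorProduct.mapL_mul, mul_one, one_mul]
    rw [this, ← mul_pow]
    refine pow_le_pow_left₀ (norm_nonneg _) ?_ 2
    refine (ContinuousLinearMap.le_opNorm _ _).trans ?_
    gcongr
    refine (TensorProduct.norm_mapL_le _ _).trans ?_
    calc ‖x i‖ * ‖(1 : ℋ →L[ℝ] ℋ)‖ ≤ c * 1 := by
          gcongr
          · exact hx i hi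
          · exact ContinuousLinearMap.norm_id_le
      _ = c := mul_one c
  refine (Finset.sum_le_sum h1).trans ?_
  rw [← Finset.mul_sum, ← norm_sum_sq s _ fun i hi j hj hij => inner_mapL_eq_zero (h i hi j hj hij) u u]
  have h2 : ∀ r : Finset ι, ∑ i ∈ r, TensorProduct.mapL (1 : 𝒢 →L[ℝ] 𝒢) (U i) u
      = TensorProduct.mapL (1 : 𝒢 →L[ℝ] 𝒢) (∑ i ∈ r, U i) u := fun r => by
    classical
    induction r using Finset.induction_on with
    | empty => simp
    | insert a r ha ih =>
      rw [Finset.sum_insert ha, Finset.sum_insert ha, TensorProduct.mapL_add_right, ih]; rfl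
  rw [h2, mul_assoc, mul_pow]
  gcongr
  refine (ContinuousLinearMap.le_opNorm _ _).trans ?_
  gcongr
  refine (TensorProduct.norm_mapL_le _ _).trans ?_
  calc ‖(1 : 𝒢 →L[ℝ] 𝒢)‖ * ‖∑ i ∈ s, U i‖ ≤ 1 * C := by
        gcongr
        exact ContinuousLinearMap.norm_id_le
    _ = C := one_mul C

theorem inner_mapL_adjoint [CompleteSpace 𝒢] [CompleteSpace ℋ] (x : 𝒢 →L[ℝ] 𝒢) (U : ℋ →L[ℝ] ℋ)
    (u v : 𝒢 ⊗[ℝ] ℋ) :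
    inner ℝ (TensorProduct.mapL x (ContinuousLinearMap.adjoint U) u) v
      = inner ℝ u (TensorProduct.mapL (ContinuousLinearMap.adjoint x) U v) := by
  induction u with
  | zero => simp
  | add a b ha hb => rw [map_add, inner_add_left, inner_add_left, ha, hb]
  | tmul a b =>
    induction v with
    | zero => simp
    | add a b ha hb => rw [map_add, inner_add_right, inner_add_right, ha, hb]
    | tmul c d =>
      simp [TensorProduct.inner_tmul, ContinuousLinearMap.adjoint_inner_left,
        ContinuousLinearMap.adjoint_inner_right]

theorem norm_sum_mapL_adjoint_le [CompleteSpace 𝒢] [CompleteSpace ℋ] {ι : Type*} (s : Finset ι)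
    (x : ι → 𝒢 →L[ℝ] 𝒢) (U : ι → ℋ →L[ℝ] ℋ)
    (h : ∀ i ∈ s, ∀ j ∈ s, i ≠ j → ∀ F G, inner ℝ (U i F) (U j G) = 0) {c C : ℝ} (hc : 0 ≤ c)
    (hx : ∀ i ∈ s, ‖x i‖ ≤ c) (hC : ‖∑ i ∈ s, U i‖ ≤ C) (u : 𝒢 ⊗[ℝ] ℋ) :
    ‖∑ i ∈ s, TensorProduct.mapL (x i) (ContinuousLinearMap.adjoint (U i)) u‖
      ≤ c * C * ‖u‖ := by
  set w := ∑ i ∈ s, TensorProduct.mapL (x i) (ContinuousLinearMap.adjoint (U i)) u with hw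
  have hC0 : 0 ≤ C := (norm_nonneg _).trans hC
  have h1 : ‖w‖ * ‖w‖ ≤ ‖u‖ * (c * C * ‖w‖) := by
    rw [← real_inner_self_eq_norm_mul_norm]
    nth_rewrite 1 [hw]
    rw [sum_inner]
    simp only [inner_mapL_adjoint]
    rw [← inner_sum s (fun i => TensorProduct.mapL (ContinuousLinearMap.adjoint (x i)) (U i) w) u]
    refine (real_inner_le_norm _ _).trans ?_
    gcongr
    refine norm_sum_mapL_le s _ U h hc (fun i hi => ?_) hC w
    rw [LinearIsometryEquiv.norm_map]; exact hx i hi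
  rcases eq_or_lt_of_le (norm_nonneg w) with h0 | h0
  · rw [← h0]; positivity
  · exact le_of_mul_le_mul_right (by linarith) h0


theorem simpleFunc_preimage_subset {α : Type*} [MeasurableSpace α] {E : Type*} [Zero E]
    {S : SimpleFunc α E} {A : Set α} (hS : Function.support S ⊆ A) {x : E} (hx : x ≠ 0) :
    S ⁻¹' {x} ⊆ A := by
  intro t ht
  refine hS ?_
  rw [Function.mem_support, show S t = x from ht]; exact hx

theorem simpleOpIntegral_eq (M : Set T → ℋ →L[ℝ] ℋ) {S : SimpleFunc T (𝒢 →L[ℝ] 𝒢)} {A : Set T}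
    (hS : Function.support S ⊆ A) :
    simpleOpIntegral M S = S.setToSimpleFunc fun s => opTensorL 𝒢 (M (s ∩ A)) := by
  refine Finset.sum_congr rfl fun x _ => ?_
  change _ = opTensor x (M (S ⁻¹' {x} ∩ A))
  by_cases hx : x = 0
  · rw [hx, opTensor_zero_left, opTensor_zero_left]
  · rw [Set.inter_eq_left.2 (simpleFunc_preimage_subset hS hx)]

theorem IsBoundedBorel.mono {A B : Set T} (hA : IsBoundedBorel A) (hB : MeasurableSet B)
    (h : B ⊆ A) : IsBoundedBorel B :=
  ⟨hB, hA.2.of_isClosed_subset isClosed_closure (closure_mono h)⟩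

theorem IsBoundedBorel.union {A B : Set T} (hA : IsBoundedBorel A) (hB : IsBoundedBorel B) :
    IsBoundedBorel (A ∪ B) :=
  ⟨hA.1.union hB.1, by rw [closure_union]; exact hA.2.union hB.2⟩

theorem simpleOpIntegral_sub {M : Set T → ℋ →L[ℝ] ℋ}
    (hM : ∀ s t, IsBoundedBorel s → IsBoundedBorel t → Disjoint s t → M (s ∪ t) = M s + M t)
    {A : Set T} (hA : IsBoundedBorel A) {S S' : SimpleFunc T (𝒢 →L[ℝ] 𝒢)}
    (hS : Function.support S ⊆ A) (hS' : Function.support S' ⊆ A) :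
    simpleOpIntegral M (S - S') = simpleOpIntegral M S - simpleOpIntegral M S' := by
  have hd : Function.support (S - S') ⊆ A := by
    intro t ht
    by_contra hn
    have h1 : S t = 0 := by by_contra h; exact hn (hS h)
    have h2 : S' t = 0 := by by_contra h; exact hn (hS' h)
    exact ht (by simp [h1, h2])
  rw [simpleOpIntegral_eq M hS, simpleOpIntegral_eq M hS', simpleOpIntegral_eq M hd]
  refine SimpleFunc.setToSimpleFunc_sub (μ := (0 : Measure T)) _ ?_ integrable_zero_measure
    integrable_zero_measure
  intro s t hs ht _ _ hst
  ext1 x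
  change opTensor x _ = opTensor x _ + opTensor x _
  rw [Set.union_inter_distrib_right, hM _ _ (hA.mono (hs.inter hA.1) Set.inter_subset_right)
    (hA.mono (ht.inter hA.1) Set.inter_subset_right)
    (hst.mono Set.inter_subset_left Set.inter_subset_left), opTensor_add_right]

/-- `M` is additive, and `‖∫ S ⊗ dM‖ ≤ K(A) ‖S‖_∞` for simple `S` that vanish outside `A`. -/
def IsIntegrator (𝒢 : Type*) [NormedAddCommGroup 𝒢] [InnerProductSpace ℝ 𝒢]
    (M : Set T → ℋ →L[ℝ] ℋ) : Prop :=
  (∀ s t, IsBoundedBorel s → IsBoundedBorel t → Disjoint s t → M (s ∪ t) = M s + M t) ∧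
    ∀ A, IsBoundedBorel A → ∃ K : ℝ, 0 ≤ K ∧ ∀ S : SimpleFunc T (𝒢 →L[ℝ] 𝒢),
      Function.support S ⊆ A → ∀ c : ℝ, 0 ≤ c → (∀ t, ‖S t‖ ≤ c) → ‖simpleOpIntegral M S‖ ≤ K * c

/-- The class `𝒵(T)`: uniform limits of simple mappings `T → 𝓛(𝒢)` that vanish outside one
relatively compact Borel set. -/
def IsTestOp (Z : T → 𝒢 →L[ℝ] 𝒢) : Prop :=
  ∃ A : Set T, IsBoundedBorel A ∧ ∃ S : ℕ → SimpleFunc T (𝒢 →L[ℝ] 𝒢),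
    (∀ n, Function.support (S n) ⊆ A) ∧ TendstoUniformly (fun n t => S n t) Z atTop

theorem IsIntegrator.exists_isOpIntegral {M : Set T → ℋ →L[ℝ] ℋ} (hM : IsIntegrator 𝒢 M)
    {Z : T → 𝒢 →L[ℝ] 𝒢} (hZ : IsTestOp Z) : ∃ Q, IsOpIntegral M Z Q := by
  obtain ⟨A, hA, S, hS, hlim⟩ := hZ
  obtain ⟨K, hK0, hK⟩ := hM.2 A hA
  have hc : CauchySeq fun n => simpleOpIntegral M (S n) := by
    rw [Metric.cauchySeq_iff']
    intro ε hε
    rw [Metric.tendstoUniformly_iff] at hlim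
    obtain ⟨N, hN⟩ := eventually_atTop.1 (hlim (ε / (4 * (K + 1))) (by positivity))
    refine ⟨N, fun n hn => ?_⟩
    rw [dist_eq_norm, ← simpleOpIntegral_sub hM.1 hA (hS n) (hS N)]
    have hd : Function.support (S n - S N) ⊆ A := by
      intro t ht
      by_contra hn'
      have h1 : S n t = 0 := by by_contra h; exact hn' (hS n h)
      have h2 : S N t = 0 := by by_contra h; exact hn' (hS N h)
      exact ht (by simp [h1, h2])
    refine (hK _ hd (ε / (2 * (K + 1))) (by positivity) fun t => ?_).trans_lt ?_
    · have h1 := hN n hn t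
      have h2 := hN N le_rfl t
      rw [SimpleFunc.coe_sub, Pi.sub_apply, ← dist_eq_norm]
      refine (dist_triangle_left _ _ (Z t)).trans ?_
      have : ε / (2 * (K + 1)) = ε / (4 * (K + 1)) + ε / (4 * (K + 1)) := by field_simp; norm_num
      linarith
    · rw [← mul_div_assoc, div_lt_iff₀ (by positivity)]
      nlinarith
  obtain ⟨Q, hQ⟩ := cauchySeq_tendsto_of_complete hc
  exact ⟨Q, A, hA, S, hS, hlim, hQ⟩

theorem IsIntegrator.isOpIntegral_unique {M : Set T → ℋ →L[ℝ] ℋ} (hM : IsIntegrator 𝒢 M)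
    {Z : T → 𝒢 →L[ℝ] 𝒢} {Q Q' : HilbertTensor 𝒢 ℋ →L[ℝ] HilbertTensor 𝒢 ℋ}
    (h : IsOpIntegral M Z Q) (h' : IsOpIntegral M Z Q') : Q = Q' := by
  obtain ⟨A, hA, S, hS, hlim, hQ⟩ := h
  obtain ⟨A', hA', S', hS', hlim', hQ'⟩ := h'
  have hB := hA.union hA'
  obtain ⟨K, hK0, hK⟩ := hM.2 _ hB
  have hSB : ∀ n, Function.support (S n) ⊆ A ∪ A' := fun n => (hS n).trans Set.subset_union_left
  have hSB' : ∀ n, Function.support (S' n) ⊆ A ∪ A' :=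
    fun n => (hS' n).trans Set.subset_union_right
  rw [← sub_eq_zero]
  refine tendsto_nhds_unique (hQ.sub hQ') ?_
  rw [Metric.tendsto_atTop]
  intro ε hε
  rw [Metric.tendstoUniformly_iff] at hlim hlim'
  obtain ⟨N, hN⟩ := eventually_atTop.1 ((hlim (ε / (4 * (K + 1))) (by positivity)).and
    (hlim' (ε / (4 * (K + 1))) (by positivity)))
  refine ⟨N, fun n hn => ?_⟩
  rw [dist_zero_right, ← simpleOpIntegral_sub hM.1 hB (hSB n) (hSB' n)]
  have hd : Function.support (S n - S' n) ⊆ A ∪ A' := by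
    intro t ht
    by_contra hn'
    have h1 : S n t = 0 := by by_contra h; exact hn' (hSB n h)
    have h2 : S' n t = 0 := by by_contra h; exact hn' (hSB' n h)
    exact ht (by simp [h1, h2])
  refine (hK _ hd (ε / (2 * (K + 1))) (by positivity) fun t => ?_).trans_lt ?_
  · have h1 := (hN n hn).1 t
    have h2 := (hN n hn).2 t
    rw [SimpleFunc.coe_sub, Pi.sub_apply, ← dist_eq_norm]
    refine (dist_triangle_left _ _ (Z t)).trans ?_
    have : ε / (2 * (K + 1)) = ε / (4 * (K + 1)) + ε / (4 * (K + 1)) := by field_simp; norm_num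
    linarith
  · rw [← mul_div_assoc, div_lt_iff₀ (by positivity)]
    nlinarith

open Classical in
/-- The operator `∫ Z ⊗ dM`. -/
def opIntegral (M : Set T → ℋ →L[ℝ] ℋ) (Z : T → 𝒢 →L[ℝ] 𝒢) :
    HilbertTensor 𝒢 ℋ →L[ℝ] HilbertTensor 𝒢 ℋ :=
  if h : ∃ Q, IsOpIntegral M Z Q then h.choose else 0

end OperatorIntegral

section ProcessIntegrator

variable [BorelSpace T] (σ : Measure T) [SFinite σ] [IsFiniteMeasureOnCompacts σ]
  (lam η : C(T, ℝ)) {ℋ : Type*} [NormedAddCommGroup ℋ] [InnerProductSpace ℝ ℋ]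
   {𝒢 : Type*} [NormedAddCommGroup 𝒢] [InnerProductSpace ℝ 𝒢]

open Classical in
/-- The set function `Δ ↦ op(χ_Δ)` on `𝓑₀(T)`. -/
def setOp (op : BoundedTestFn T → ℋ →L[ℝ] ℋ) (Δ : Set T) : ℋ →L[ℝ] ℋ :=
  if h : IsBoundedBorel Δ then op (.indicator Δ h) else 0

/-- Additivity of `f ↦ op(f)`. -/
def OpAdditive (op : BoundedTestFn T → ℋ →L[ℝ] ℋ) : Prop :=
  ∀ f g h : BoundedTestFn T, (∀ t, h.toFun t = f.toFun t + g.toFun t) → op h = op f + op g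

theorem setOp_union {op : BoundedTestFn T → ℋ →L[ℝ] ℋ} (hop : OpAdditive op) {s t : Set T}
    (hs : IsBoundedBorel s) (ht : IsBoundedBorel t) (hst : Disjoint s t) :
    setOp op (s ∪ t) = setOp op s + setOp op t := by
  rw [setOp, setOp, setOp, dif_pos hs, dif_pos ht, dif_pos (hs.union ht)]
  refine hop _ _ _ fun x => ?_
  simp only [BoundedTestFn.indicator]
  rw [Set.indicator_union_of_disjoint hst]

theorem isBoundedBorel_empty : IsBoundedBorel (∅ : Set T) := ⟨.empty, by simp⟩

theorem setOp_empty {op : BoundedTestFn T → ℋ →L[ℝ] ℋ} (hop : OpAdditive op) :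
    setOp op ∅ = 0 := by
  have := setOp_union hop isBoundedBorel_empty isBoundedBorel_empty (Set.disjoint_empty _)
  simpa using this

theorem sum_setOp {op : BoundedTestFn T → ℋ →L[ℝ] ℋ} (hop : OpAdditive op) {A : Set T}
    (hA : IsBoundedBorel A) {E : Type*} [Zero E] {S : SimpleFunc T E}
    (hS : Function.support S ⊆ A) (r : Finset E) (hr : ∀ x ∈ r, x ≠ 0) :
    ∑ x ∈ r, setOp op (S ⁻¹' {x}) = setOp op (S ⁻¹' r) := by
  classical
  induction r using Finset.induction_on with
  | empty => simp [setOp_empty hop]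
  | insert a r ha ih =>
    have hsub : S ⁻¹' (r : Set E) ⊆ A := fun t ht =>
      simpleFunc_preimage_subset hS (hr (S t) (Finset.mem_insert_of_mem ht)) rfl
    rw [Finset.sum_insert ha, ih fun x hx => hr x (Finset.mem_insert_of_mem hx),
      Finset.coe_insert, Set.insert_eq, Set.preimage_union, setOp_union hop]
    · exact hA.mono (S.measurableSet_preimage _)
        (simpleFunc_preimage_subset hS (hr a (Finset.mem_insert_self _ _)))
    · exact hA.mono (S.measurableSet_preimage _) hsub
    · refine Disjoint.preimage _ ?_
      simpa using ha

theorem indicator_le {A B : Set T} (hB : IsBoundedBorel B) (h : B ⊆ A) (t : T) :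
    |(BoundedTestFn.indicator B hB).toFun t| ≤ A.indicator (fun _ => ((1 : ℝ≥0) : ℝ)) t := by
  simp only [BoundedTestFn.indicator]
  by_cases h1 : t ∈ B
  · simp [h1, h h1]
  · by_cases h2 : t ∈ A <;> simp [h1, h2]

theorem norm_sum_opTensor_le {op : BoundedTestFn T → ℋ →L[ℝ] ℋ} (hop : OpAdditive op)
    (horth : ∀ f g : BoundedTestFn T, (∀ t, f.toFun t * g.toFun t = 0) →
      ∀ F G, inner ℝ (op f F) (op g G) = 0)
    {A : Set T} (hA : IsBoundedBorel A) {K : ℝ} (hK0 : 0 ≤ K)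
    (hK : ∀ B (hB : IsBoundedBorel B), B ⊆ A → ‖op (.indicator B hB)‖ ≤ K)
    {S : SimpleFunc T (𝒢 →L[ℝ] 𝒢)}
    (hS : Function.support S ⊆ A) {c : ℝ} (hc : 0 ≤ c) (hSc : ∀ t, ‖S t‖ ≤ c) :
    ‖∑ x ∈ S.range, opTensor x (setOp op (S ⁻¹' {x}))‖ ≤ K * c ∧
    (∀ [CompleteSpace 𝒢] [CompleteSpace ℋ],
    ‖∑ x ∈ S.range, opTensor x (ContinuousLinearMap.adjoint (setOp op (S ⁻¹' {x})))‖ ≤ K * c) := by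
  classical
  have hfil : ∀ N : Set T → ℋ →L[ℝ] ℋ, ∑ x ∈ S.range, opTensor x (N (S ⁻¹' {x}))
      = ∑ x ∈ S.range with x ≠ 0, opTensor x (N (S ⁻¹' {x})) := fun N => by
    rw [Finset.sum_filter]
    refine Finset.sum_congr rfl fun x _ => ?_
    by_cases hx : x = 0
    · simp [hx, opTensor_zero_left]
    · simp [hx]
  set r := S.range.filter (· ≠ 0) with hr
  have hr0 : ∀ x ∈ r, x ≠ 0 := fun x hx => (Finset.mem_filter.1 hx).2
  have hbd : ∀ x ∈ r, IsBoundedBorel (S ⁻¹' {x}) := fun x hx =>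
    hA.mono (S.measurableSet_preimage _) (simpleFunc_preimage_subset hS (hr0 x hx))
  have h1 : ∀ i ∈ r, ∀ j ∈ r, i ≠ j → ∀ F G,
      inner ℝ (setOp op (S ⁻¹' {i}) F) (setOp op (S ⁻¹' {j}) G) = 0 := by
    intro i hi j hj hij F G
    rw [setOp, setOp, dif_pos (hbd i hi), dif_pos (hbd j hj)]
    refine horth _ _ (fun t => ?_) F G
    simp only [BoundedTestFn.indicator]
    by_cases ht : S t = i
    · have : S t ≠ j := fun h => hij (ht.symm.trans h)
      simp [this]
    · simp [ht]
  have h2 : ‖∑ x ∈ r, setOp op (S ⁻¹' {x})‖ ≤ K := by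
    rw [sum_setOp hop hA hS r hr0]
    have hsub : S ⁻¹' (r : Set (𝒢 →L[ℝ] 𝒢)) ⊆ A := fun t ht =>
      simpleFunc_preimage_subset hS (hr0 (S t) ht) rfl
    have hb : IsBoundedBorel (S ⁻¹' (r : Set (𝒢 →L[ℝ] 𝒢))) :=
      hA.mono (S.measurableSet_preimage _) hsub
    rw [setOp, dif_pos hb]
    exact hK _ hb hsub
  have h3 : ∀ x ∈ r, ‖x‖ ≤ c := fun x hx => by
    obtain ⟨t, rfl⟩ := SimpleFunc.mem_range.1 (Finset.mem_filter.1 hx).1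
    exact hSc t
  have hsum : ∀ (s : Finset (𝒢 →L[ℝ] 𝒢)) (N : (𝒢 →L[ℝ] 𝒢) → ℋ →L[ℝ] ℋ) (u : 𝒢 ⊗[ℝ] ℋ),
      (∑ x ∈ s, opTensor x (N x)) (toTensor u)
        = toTensor (∑ x ∈ s, TensorProduct.mapL x (N x) u) := by
    intro s N u
    induction s using Finset.induction_on with
    | empty => simp
    | insert a s ha ih =>
      rw [Finset.sum_insert ha, Finset.sum_insert ha, add_apply, ih, opTensor_coe,
        map_add]
  refine ⟨?_, ?_⟩
  · rw [hfil]
    refine opNorm_completion_le (by positivity) fun u => ?_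
    rw [hsum r (fun x => setOp op (S ⁻¹' {x})), toTensor.norm_map, mul_comm K c]
    exact norm_sum_mapL_le r (fun x => x) _ h1 hc h3 h2 u
  · intro _ _
    rw [hfil fun s => ContinuousLinearMap.adjoint (setOp op s)]
    refine opNorm_completion_le (by positivity) fun u => ?_
    rw [hsum r (fun x => ContinuousLinearMap.adjoint (setOp op (S ⁻¹' {x}))),
      toTensor.norm_map, mul_comm K c]
    exact norm_sum_mapL_adjoint_le r (fun x => x) _ h1 hc h3 h2 u

theorem processMeasure_eq (Δ : Set T) : processMeasure σ lam η Δ =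
    setOp (creation σ η) Δ + setOp (neutral σ lam η) Δ +
      ContinuousLinearMap.adjoint (setOp (creation σ η) Δ) := by
  unfold processMeasure setOp
  by_cases h : IsBoundedBorel Δ
  · simp only [dif_pos h]; rfl
  · simp only [dif_neg h]; simp

theorem isIntegrator_processMeasure [CompleteSpace 𝒢] :
    IsIntegrator 𝒢 (processMeasure σ lam η) := by
  have hc : OpAdditive (creation σ η) := fun f g h => creation_add σ η
  have hn : OpAdditive (neutral σ lam η) := fun f g h => neutral_add σ lam η
  refine ⟨fun s t hs ht hst => ?_, fun A hA => ?_⟩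
  · rw [processMeasure_eq, processMeasure_eq, processMeasure_eq, setOp_union hc hs ht hst,
      setOp_union hn hs ht hst, map_add]
    abel
  · obtain ⟨S₀, E, L, hS₀, hE, hL⟩ := exists_bounds σ lam η hA
    set K₁ : ℝ := ((1 * NNReal.sqrt (S₀ + E) : ℝ≥0) : ℝ)
    set K₂ : ℝ := ((1 * L : ℝ≥0) : ℝ)
    have hK₁ : 0 ≤ K₁ := NNReal.coe_nonneg _
    have hK₂ : 0 ≤ K₂ := NNReal.coe_nonneg _
    refine ⟨K₁ + K₂ + K₁, by positivity, fun S hS c hc0 hSc => ?_⟩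
    have e1 := norm_sum_opTensor_le hc (fun f g h => inner_creation_eq_zero σ η h) hA hK₁
      (fun B hB hBA => norm_creation_le σ η hA.1 hS₀ hE (indicator_le hB hBA)) hS hc0 hSc
    have e2 := norm_sum_opTensor_le hn (fun f g h => inner_neutral_eq_zero σ lam η h) hA hK₂
      (fun B hB hBA => norm_neutral_le σ lam η hL (indicator_le hB hBA)) hS hc0 hSc
    have : simpleOpIntegral (processMeasure σ lam η) S =
        ∑ x ∈ S.range, opTensor x (setOp (creation σ η) (S ⁻¹' {x}))
        + ∑ x ∈ S.range, opTensor x (setOp (neutral σ lam η) (S ⁻¹' {x}))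
        + ∑ x ∈ S.range, opTensor x
            (ContinuousLinearMap.adjoint (setOp (creation σ η) (S ⁻¹' {x}))) := by
      rw [simpleOpIntegral, ← Finset.sum_add_distrib, ← Finset.sum_add_distrib]
      refine Finset.sum_congr rfl fun x _ => ?_
      rw [processMeasure_eq, opTensor_add_right, opTensor_add_right]
    rw [this, add_mul, add_mul]
    exact (norm_add₃_le).trans (add_le_add_three e1.1 e2.1 e1.2)

/-- For every `Z ∈ 𝒵(T)` the integral `∫ Z ⊗ dM` exists and is unique. -/
theorem existsUnique_isOpIntegral [CompleteSpace 𝒢] {Z : T → 𝒢 →L[ℝ] 𝒢} (hZ : IsTestOp Z) :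
    ∃! Q, IsOpIntegral (processMeasure σ lam η) Z Q := by
  have hM := isIntegrator_processMeasure σ lam η (𝒢 := 𝒢)
  obtain ⟨Q, hQ⟩ := hM.exists_isOpIntegral hZ
  exact ⟨Q, hQ, fun Q' hQ' => hM.isOpIntegral_unique hQ' hQ⟩

end ProcessIntegrator


/-! ### Polynomials and the generating function -/

section GeneratingFunction

variable [BorelSpace T] (σ : Measure T) [SFinite σ] [IsFiniteMeasureOnCompacts σ]
  (lam η : C(T, ℝ)) {𝒢 : Type*} [NormedAddCommGroup 𝒢] [InnerProductSpace ℝ 𝒢]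

/-- `‖Z‖_∞ = sup_t ‖Z(t)‖`. -/
def opSupNorm (Z : T → 𝒢 →L[ℝ] 𝒢) : ℝ := ⨆ t, ‖Z t‖

/-- `⟨ω, Z⟩ = ∫ Z ⊗ dM`, where `M(Δ) = X(χ_Δ)`. -/
def pairing (Z : T → 𝒢 →L[ℝ] 𝒢) :
    HilbertTensor 𝒢 (ExtFock σ η) →L[ℝ] HilbertTensor 𝒢 (ExtFock σ η) :=
  opIntegral (processMeasure σ lam η) Z

/-- An operator `x` in `𝒢` regarded as the operator `x ⊗ 1` in `𝒢 ⊗ 𝔽`. -/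
def leftOp (x : 𝒢 →L[ℝ] 𝒢) :
    HilbertTensor 𝒢 (ExtFock σ η) →L[ℝ] HilbertTensor 𝒢 (ExtFock σ η) :=
  opTensor x 1

/-- `⟨P⁽ⁿ⁾(ω), Z₁ ⊛ ⋯ ⊛ Zₙ⟩` for the list `[Z₁, …, Zₙ]`. The last term of the recursion carries
the factor `[n-2]₀`, which is `0` for `n = 2` and `1` for `n ≥ 3`. -/
def orthPoly : List (T → 𝒢 →L[ℝ] 𝒢) →
    HilbertTensor 𝒢 (ExtFock σ η) →L[ℝ] HilbertTensor 𝒢 (ExtFock σ η)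
  | [] => 1
  | [Z₁] => pairing σ lam η Z₁
  | [Z₁, Z₂] =>
      pairing σ lam η Z₁ * orthPoly [Z₂]
        - orthPoly [fun t => lam t • (Z₁ t * Z₂ t)]
        - leftOp σ η (∫ t, Z₁ t * Z₂ t ∂σ) * orthPoly []
  | Z₁ :: Z₂ :: Z₃ :: L =>
      pairing σ lam η Z₁ * orthPoly (Z₂ :: Z₃ :: L)
        - orthPoly ((fun t => lam t • (Z₁ t * Z₂ t)) :: Z₃ :: L)
        - leftOp σ η (∫ t, Z₁ t * Z₂ t ∂σ) * orthPoly (Z₃ :: L)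
        - orthPoly ((fun t => η t • (Z₁ t * Z₂ t * Z₃ t)) :: L)
  termination_by l => l.length

/-- The `n`-th term `⟨P⁽ⁿ⁾(ω), Z^{⊛n}⟩` of the generating function. -/
def genTerm (Z : T → 𝒢 →L[ℝ] 𝒢) (n : ℕ) :
    HilbertTensor 𝒢 (ExtFock σ η) →L[ℝ] HilbertTensor 𝒢 (ExtFock σ η) :=
  orthPoly σ lam η (List.replicate n Z)

/-- `G(Z, ω) = ∑ₙ ⟨P⁽ⁿ⁾(ω), Z^{⊛n}⟩`. -/
def genFun (Z : T → 𝒢 →L[ℝ] 𝒢) :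
    HilbertTensor 𝒢 (ExtFock σ η) →L[ℝ] HilbertTensor 𝒢 (ExtFock σ η) :=
  ∑' n, genTerm σ lam η Z n

/-- Taylor series at `0` of `x ↦ x ^ l / (1 + a x + b x ^ 2)`. -/
def ratioSeries (l : ℕ) (a b : ℝ) : PowerSeries ℝ :=
  PowerSeries.X ^ l * (1 + PowerSeries.C a * PowerSeries.X + PowerSeries.C b * PowerSeries.X ^ 2)⁻¹

/-- The operator-valued function `Z ^ l / (1 + λ Z + η Z ^ 2)`, where the quotient at `t` is the
Taylor series of `x ^ l / (1 + λ(t) x + η(t) x ^ 2)` evaluated at the operator `Z(t)`. For `l = 1`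
this is `Ψ_{λ,η}(Z)`, for `l = 2` it is `C_{λ,η}(Ψ_{λ,η}(Z))`. -/
def ratioOp (l : ℕ) (Z : T → 𝒢 →L[ℝ] 𝒢) (t : T) : 𝒢 →L[ℝ] 𝒢 :=
  ∑' n, PowerSeries.coeff n (ratioSeries l (lam t) (η t)) • Z t ^ n

end GeneratingFunction

end FreeMeixner
end

open FreeMeixner

/-!
The theorem rests on a functional equation for the generating function with its first argument
freed. For `Y`, `Z` in `𝒵(T)` that vanish outside `A`, put
`G(Y) = ∑ₙ ⟨P⁽ⁿ⁺¹⁾(ω), Y ⊛ Z^{⊛n}⟩`. Summing the recursion of the polynomials over `n` gives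
`G(Y) = ⟨ω, Y⟩ G(Z, ω) - G(λ Y Z) - ∫ Y Z dσ G(Z, ω) - G(η Y Z²)`, that is, because `G` is additive,
`G(Y (1 + λ Z + η Z²)) = (⟨ω, Y⟩ - ∫ Y Z dσ) G(Z, ω)` (`HasBoundsOn.tsum_headTerm_eq`).
For `Y = Ψ = Z / (1 + λ Z + η Z²)` the left-hand side is `G(Z) = G(Z, ω) - 1`, and so
`(1 - ⟨ω, Ψ⟩ + ∫ Ψ Z dσ) G(Z, ω) = 1` (`HasBoundsOn.resolvent_mul_genFun`). The first factor is
within distance `1` of the identity when `‖Z‖_∞` is small, hence it is invertible, which is the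
resolvent formula; the second form follows by factoring out `1 + ∫ Ψ Z dσ`.

Three estimates make this rigorous. First, `‖⟨ω, Y⟩‖ ≤ K ‖Y‖_∞` with a constant that depends only on
`A` and not on `𝒢` (`norm_pairing_le`). Second, the recursion then yields
`‖⟨P⁽ⁿ⁺¹⁾(ω), Y ⊛ Z^{⊛n}⟩‖ ≤ ‖Y‖_∞ D (2 D ‖Z‖_∞)ⁿ` (`HasBoundsOn.norm_headTerm_le`), so that all the
series converge absolutely for `‖Z‖_∞ < 1 / (4 D)`. Third, the Taylor coefficients of
`x / (1 + a x + b x²)` grow at most like `(1 + |a| + |b|)ⁿ` (`abs_coeff_ratioSeries_one_le`) and are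
continuous in `a` and `b`, so `Ψ` is a uniform limit of elements of `𝒵(T)`.
-/

namespace FreeMeixner

/-! ### Uniform limits of simple mappings -/

section SimpleLimits

variable {T : Type*} [TopologicalSpace T] [MeasurableSpace T]
  {E F H : Type*} [NormedAddCommGroup E] [NormedSpace ℝ E] [NormedAddCommGroup F] [NormedSpace ℝ F]
  [NormedAddCommGroup H] [NormedSpace ℝ H] {A : Set T}

/-- `f` is a uniform limit of simple mappings that vanish outside `A`. -/
def IsSimpleLimitOn (A : Set T) (f : T → E) : Prop :=
  ∀ ε > 0, ∃ S : SimpleFunc T E, Function.support S ⊆ A ∧ ∀ t, ‖f t - S t‖ ≤ ε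

theorem IsSimpleLimitOn.eq_zero {f : T → E} (hf : IsSimpleLimitOn A f) {t : T} (ht : t ∉ A) :
    f t = 0 := by
  refine norm_le_zero_iff.1 (le_of_forall_pos_le_add fun ε hε => ?_)
  obtain ⟨S, hS, h⟩ := hf ε hε
  have h0 : S t = 0 := by by_contra h; exact ht (hS h)
  simpa [h0] using h t

theorem IsSimpleLimitOn.exists_bound {f : T → E} (hf : IsSimpleLimitOn A f) :
    ∃ c : ℝ, 0 ≤ c ∧ ∀ t, ‖f t‖ ≤ c := by
  obtain ⟨S, -, h⟩ := hf 1 one_pos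
  obtain ⟨C, hC⟩ := S.exists_forall_norm_le
  refine ⟨max (1 + C) 0, le_max_right _ _, fun t => le_max_of_le_left ?_⟩
  calc ‖f t‖ = ‖(f t - S t) + S t‖ := by rw [sub_add_cancel]
    _ ≤ _ := norm_add_le_of_le (h t) (hC t)

theorem IsSimpleLimitOn.exists_seq {f : T → E} (hf : IsSimpleLimitOn A f) :
    ∃ S : ℕ → SimpleFunc T E, (∀ n, Function.support (S n) ⊆ A) ∧
      TendstoUniformly (fun n t => S n t) f atTop := by
  choose S hS h using fun n : ℕ => hf (1 / ((n : ℝ) + 1)) Nat.one_div_pos_of_nat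
  refine ⟨S, hS, Metric.tendstoUniformly_iff.2 fun ε hε => ?_⟩
  filter_upwards [tendsto_one_div_add_atTop_nhds_zero_nat.eventually_lt_const hε] with n hn t
  rw [dist_eq_norm]
  exact (h n t).trans_lt hn

theorem IsSimpleLimitOn.of_tendstoUniformly {f : T → E} {u : ℕ → T → E}
    (hu : ∀ n, IsSimpleLimitOn A (u n)) (h : TendstoUniformly u f atTop) :
    IsSimpleLimitOn A f := by
  intro ε hε
  obtain ⟨N, hN⟩ := (Metric.tendstoUniformly_iff.1 h (ε / 2) (by positivity)).exists
  obtain ⟨S, hS, h⟩ := hu N (ε / 2) (by positivity)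
  refine ⟨S, hS, fun t => ?_⟩
  have h1 := hN t
  rw [dist_eq_norm] at h1
  calc ‖f t - S t‖ = ‖(f t - u N t) + (u N t - S t)‖ := by rw [sub_add_sub_cancel]
    _ ≤ ε / 2 + ε / 2 := norm_add_le_of_le h1.le (h t)
    _ = ε := add_halves ε

theorem IsSimpleLimitOn.zero : IsSimpleLimitOn A (fun _ : T => (0 : E)) :=
  fun ε hε => ⟨0, by simp, fun t => by simpa using hε.le⟩

theorem IsSimpleLimitOn.add {f g : T → E} (hf : IsSimpleLimitOn A f) (hg : IsSimpleLimitOn A g) :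
    IsSimpleLimitOn A (fun t => f t + g t) := by
  intro ε hε
  obtain ⟨S, hS, h⟩ := hf (ε / 2) (by positivity)
  obtain ⟨U, hU, h'⟩ := hg (ε / 2) (by positivity)
  refine ⟨S + U, ?_, fun t => ?_⟩
  · rw [SimpleFunc.coe_add]
    exact (Function.support_add _ _).trans (Set.union_subset hS hU)
  · calc ‖f t + g t - (S + U) t‖ = ‖(f t - S t) + (g t - U t)‖ := by
          rw [SimpleFunc.coe_add, Pi.add_apply]; congr 1; abel
      _ ≤ ε / 2 + ε / 2 := norm_add_le_of_le (h t) (h' t)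
      _ = ε := add_halves ε

theorem IsSimpleLimitOn.sum {ι : Type*} {s : Finset ι} {f : ι → T → E}
    (hf : ∀ i ∈ s, IsSimpleLimitOn A (f i)) : IsSimpleLimitOn A (fun t => ∑ i ∈ s, f i t) := by
  classical
  induction s using Finset.induction_on with
  | empty => simpa using IsSimpleLimitOn.zero
  | insert a s ha ih =>
    simp only [Finset.sum_insert ha]
    exact (hf a (s.mem_insert_self a)).add
      (ih fun i hi => hf i (Finset.mem_insert_of_mem hi))

theorem IsSimpleLimitOn.bilin (B : E →L[ℝ] F →L[ℝ] H) {f : T → E} {g : T → F}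
    (hf : IsSimpleLimitOn A f) (hg : IsSimpleLimitOn A g) :
    IsSimpleLimitOn A (fun t => B (f t) (g t)) := by
  intro ε hε
  obtain ⟨a, ha0, ha⟩ := hf.exists_bound
  obtain ⟨b, hb0, hb⟩ := hg.exists_bound
  have hc : 0 < ‖B‖ * (a + 1 + b) + 1 := by positivity
  have hδ : 0 < min 1 (ε / (‖B‖ * (a + 1 + b) + 1)) := lt_min one_pos (by positivity)
  set δ := min 1 (ε / (‖B‖ * (a + 1 + b) + 1)) with hδ'
  obtain ⟨S, hS, h⟩ := hf δ hδ
  obtain ⟨U, -, h'⟩ := hg δ hδ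
  refine ⟨(S.pair U).map fun p => B p.1 p.2, fun t ht => ?_, fun t => ?_⟩
  · refine hS fun h0 => ht ?_
    simp [h0]
  · have hSt : ‖S t‖ ≤ a + 1 := by
      calc ‖S t‖ = ‖f t - (f t - S t)‖ := by rw [sub_sub_cancel]
        _ ≤ a + 1 := norm_sub_le_of_le (ha t) ((h t).trans (min_le_left _ _))
    have e : B (f t) (g t) - ((S.pair U).map fun p => B p.1 p.2) t
        = B (f t - S t) (g t) + B (S t) (g t - U t) := by
      simp only [SimpleFunc.map_apply, SimpleFunc.pair_apply, map_sub, sub_apply]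
      abel
    rw [e]
    have e1 : ‖B (f t - S t) (g t)‖ ≤ ‖B‖ * δ * b :=
      (B.le_opNorm₂ _ _).trans (by gcongr; exacts [h t, hb t])
    have e2 : ‖B (S t) (g t - U t)‖ ≤ ‖B‖ * (a + 1) * δ :=
      (B.le_opNorm₂ _ _).trans (by gcongr; exact h' t)
    have e3 : δ * (‖B‖ * (a + 1 + b) + 1) ≤ ε :=
      (le_div_iff₀ hc).1 (min_le_right _ _)
    linarith [norm_add_le_of_le e1 e2]

/-- Rounding down to multiples of `ε` turns a bounded measurable function into a simple one. -/
theorem isSimpleLimitOn_indicator {φ : T → ℝ} (hφ : Measurable φ) (hA : MeasurableSet A) {c : ℝ}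
    (hc : ∀ t ∈ A, |φ t| ≤ c) : IsSimpleLimitOn A (A.indicator φ) := by
  intro ε hε
  set g : T → ℝ := A.indicator φ
  have hg : Measurable g := hφ.indicator hA
  have hgc : ∀ t, |g t| ≤ |c| := fun t => by
    by_cases ht : t ∈ A
    · simpa [g, ht] using (hc t ht).trans (le_abs_self c)
    · simp [g, ht]
  have hm : Measurable fun t => (⌊g t / ε⌋ : ℤ) := (hg.div_const ε).floor
  refine ⟨⟨fun t => ε * ⌊g t / ε⌋, fun x => ?_, ?_⟩, fun t ht => ?_, fun t => ?_⟩
  · exact ((measurable_from_top (f := fun k : ℤ => ε * (k : ℝ))).comp hm) (measurableSet_singleton x)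
  · refine ((Set.finite_Icc ⌊-|c| / ε⌋ ⌊|c| / ε⌋).image fun k : ℤ => ε * (k : ℝ)).subset ?_
    rintro _ ⟨t, rfl⟩
    refine ⟨_, ⟨Int.floor_mono ?_, Int.floor_mono ?_⟩, rfl⟩
    · exact div_le_div_of_nonneg_right (neg_le_of_abs_le (hgc t)) hε.le
    · exact div_le_div_of_nonneg_right (le_of_abs_le (hgc t)) hε.le
  · by_contra h
    exact ht (by simp [g, h])
  · have h1 := Int.floor_le (g t / ε)
    have h2 := Int.lt_floor_add_one (g t / ε)
    rw [le_div_iff₀ hε] at h1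
    rw [div_lt_iff₀ hε] at h2
    rw [Real.norm_eq_abs, abs_le]
    simp only [SimpleFunc.coe_mk]
    constructor <;> nlinarith

theorem IsSimpleLimitOn.continuous_smul [BorelSpace T] {φ : T → ℝ} (hφ : Continuous φ)
    (hA : IsBoundedBorel A) {f : T → E} (hf : IsSimpleLimitOn A f) :
    IsSimpleLimitOn A (fun t => φ t • f t) := by
  obtain ⟨c, hc⟩ := hA.2.exists_bound_of_continuousOn hφ.continuousOn
  have h := (isSimpleLimitOn_indicator hφ.measurable hA.1
    fun t ht => hc t (subset_closure ht)).bilin (ContinuousLinearMap.lsmul ℝ ℝ) hf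
  convert h using 2 with t
  by_cases ht : t ∈ A
  · simp [ht]
  · simp [hf.eq_zero ht]

theorem IsSimpleLimitOn.stronglyMeasurable {f : T → E} (hf : IsSimpleLimitOn A f) :
    StronglyMeasurable f := by
  obtain ⟨S, -, h⟩ := hf.exists_seq
  exact ⟨S, fun t => h.tendsto_at t⟩

theorem IsSimpleLimitOn.integrable {σ : Measure T} [IsFiniteMeasureOnCompacts σ]
    (hA : IsBoundedBorel A) {f : T → E} (hf : IsSimpleLimitOn A f) : Integrable f σ := by
  obtain ⟨c, -, hc⟩ := hf.exists_bound
  have hσ : σ A < ∞ := (measure_mono subset_closure).trans_lt hA.2.measure_lt_top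
  have h : IntegrableOn f A σ := by
    have : IsFiniteMeasure (σ.restrict A) := ⟨by simpa using hσ⟩
    exact Integrable.of_bound hf.stronglyMeasurable.aestronglyMeasurable c
      (Eventually.of_forall hc)
  refine h.integrable_of_forall_notMem_eq_zero fun t ht => hf.eq_zero ht

theorem IsSimpleLimitOn.norm_integral_le {σ : Measure T} {S : ℝ≥0} (hS : σ A ≤ S)
    {f : T → E} (hf : IsSimpleLimitOn A f) {c : ℝ} (hc : ∀ t, ‖f t‖ ≤ c) (hc0 : 0 ≤ c) :
    ‖∫ t, f t ∂σ‖ ≤ S * c := by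
  rw [← setIntegral_eq_integral_of_forall_compl_eq_zero (s := A) fun t ht => hf.eq_zero ht]
  refine (norm_setIntegral_le_of_norm_le_const (hS.trans_lt ENNReal.coe_lt_top)
    fun t _ => hc t).trans ?_
  rw [mul_comm]
  gcongr
  exact ENNReal.toReal_le_coe_of_le_coe hS

end SimpleLimits

section TestOp

variable {T : Type*} [TopologicalSpace T] [MeasurableSpace T]
  {𝒢 : Type*} [NormedAddCommGroup 𝒢] [InnerProductSpace ℝ 𝒢] {A : Set T}

theorem IsSimpleLimitOn.mul {Y Z : T → 𝒢 →L[ℝ] 𝒢} (hY : IsSimpleLimitOn A Y)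
    (hZ : IsSimpleLimitOn A Z) : IsSimpleLimitOn A (fun t => Y t * Z t) :=
  hY.bilin (ContinuousLinearMap.mul ℝ (𝒢 →L[ℝ] 𝒢)) hZ

theorem IsSimpleLimitOn.isTestOp (hA : IsBoundedBorel A) {Z : T → 𝒢 →L[ℝ] 𝒢}
    (hZ : IsSimpleLimitOn A Z) : IsTestOp Z :=
  ⟨A, hA, hZ.exists_seq⟩

/-- The simple mappings that approximate `Z` may be restricted to any measurable set outside which
`Z` vanishes. -/
theorem IsTestOp.isSimpleLimitOn (hA : MeasurableSet A) {Z : T → 𝒢 →L[ℝ] 𝒢} (hZ : IsTestOp Z)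
    (hs : Function.support Z ⊆ A) : IsSimpleLimitOn A Z := by
  obtain ⟨B, -, S, -, hlim⟩ := hZ
  intro ε hε
  obtain ⟨N, hN⟩ := (Metric.tendstoUniformly_iff.1 hlim ε hε).exists
  refine ⟨(S N).restrict A, ?_, fun t => ?_⟩
  · rw [SimpleFunc.coe_restrict _ hA]
    exact Set.support_indicator_subset
  · rw [SimpleFunc.coe_restrict _ hA]
    by_cases ht : t ∈ A
    · have := hN t
      rw [dist_eq_norm] at this
      simpa [ht] using this.le
    · have : Z t = 0 := by by_contra h; exact ht (hs h)
      simpa [ht, this] using hε.le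

theorem norm_le_opSupNorm {Z : T → 𝒢 →L[ℝ] 𝒢} (hZ : IsSimpleLimitOn A Z) (t : T) :
    ‖Z t‖ ≤ opSupNorm Z := by
  obtain ⟨c, -, hc⟩ := hZ.exists_bound
  exact le_ciSup (f := fun t => ‖Z t‖) ⟨c, by rintro _ ⟨t, rfl⟩; exact hc t⟩ t

end TestOp

/-! ### Linearity and norm bounds of the integrals -/

section OpIntegralBounds

variable {T : Type*} [TopologicalSpace T] [MeasurableSpace T]
  {𝒢 : Type*} [NormedAddCommGroup 𝒢] [InnerProductSpace ℝ 𝒢]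
  {ℋ : Type*} [NormedAddCommGroup ℋ] [InnerProductSpace ℝ ℋ]

theorem IsIntegrator.isOpIntegral_sub {M : Set T → ℋ →L[ℝ] ℋ} (hM : IsIntegrator 𝒢 M)
    {Z Z' : T → 𝒢 →L[ℝ] 𝒢} {Q Q' : HilbertTensor 𝒢 ℋ →L[ℝ] HilbertTensor 𝒢 ℋ}
    (h : IsOpIntegral M Z Q) (h' : IsOpIntegral M Z' Q') :
    IsOpIntegral M (fun t => Z t - Z' t) (Q - Q') := by
  obtain ⟨A, hA, S, hS, hlim, hQ⟩ := h
  obtain ⟨A', hA', S', hS', hlim', hQ'⟩ := h'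
  have h1 : ∀ n, Function.support (S n) ⊆ A ∪ A' := fun n =>
    (hS n).trans Set.subset_union_left
  have h2 : ∀ n, Function.support (S' n) ⊆ A ∪ A' := fun n =>
    (hS' n).trans Set.subset_union_right
  refine ⟨A ∪ A', hA.union hA', fun n => S n - S' n, fun n => ?_, hlim.sub hlim', ?_⟩
  · rw [SimpleFunc.coe_sub]
    exact (Function.support_sub _ _).trans (Set.union_subset (h1 n) (h2 n))
  · simpa only [simpleOpIntegral_sub hM.1 (hA.union hA') (h1 _) (h2 _)] using hQ.sub hQ'

/-- A bound for the integrals of simple mappings vanishing outside `A` passes to their uniform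
limits. -/
theorem IsIntegrator.norm_isOpIntegral_le {M : Set T → ℋ →L[ℝ] ℋ} (hM : IsIntegrator 𝒢 M)
    {A : Set T} (hA : IsBoundedBorel A) {K : ℝ} (hK0 : 0 ≤ K)
    (hK : ∀ S : SimpleFunc T (𝒢 →L[ℝ] 𝒢), Function.support S ⊆ A → ∀ c : ℝ, 0 ≤ c →
      (∀ t, ‖S t‖ ≤ c) → ‖simpleOpIntegral M S‖ ≤ K * c)
    {Z : T → 𝒢 →L[ℝ] 𝒢} (hZ : IsSimpleLimitOn A Z)
    {Q : HilbertTensor 𝒢 ℋ →L[ℝ] HilbertTensor 𝒢 ℋ} (h : IsOpIntegral M Z Q) {c : ℝ}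
    (hc0 : 0 ≤ c) (hc : ∀ t, ‖Z t‖ ≤ c) : ‖Q‖ ≤ K * c := by
  -- The simple mappings that define `Q` may live on a set `A'` larger than `A`. They are compared
  -- on `A ∪ A'` with a simple mapping `U` that vanishes outside `A`.
  obtain ⟨A', hA', S, hS, hlim, hQ⟩ := h
  have hB := hA.union hA'
  obtain ⟨K', hK'0, hK'⟩ := hM.2 _ hB
  refine le_of_forall_pos_le_add fun ε hε => ?_
  have hD : 0 < K + 2 * K' + 1 := by positivity
  have hδ : 0 < ε / (K + 2 * K' + 1) := by positivity
  set δ := ε / (K + 2 * K' + 1) with hδ'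
  have hδε : δ * (K + 2 * K' + 1) = ε := div_mul_cancel₀ _ hD.ne'
  obtain ⟨U, hU, hUZ⟩ := hZ δ hδ
  have hUc : ∀ t, ‖U t‖ ≤ c + δ := fun t => by
    calc ‖U t‖ = ‖Z t - (Z t - U t)‖ := by rw [sub_sub_cancel]
      _ ≤ c + δ := norm_sub_le_of_le (hc t) (hUZ t)
  have hUint := hK U hU (c + δ) (by positivity) hUc
  refine le_of_tendsto hQ.norm ?_
  filter_upwards [Metric.tendstoUniformly_iff.1 hlim δ hδ] with n hn
  have h1 : Function.support (S n) ⊆ A ∪ A' := (hS n).trans Set.subset_union_right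
  have h2 : Function.support U ⊆ A ∪ A' := hU.trans Set.subset_union_left
  have h3 : ‖simpleOpIntegral M (S n - U)‖ ≤ K' * (δ + δ) := by
    refine hK' _ ?_ _ (by positivity) fun t => ?_
    · rw [SimpleFunc.coe_sub]
      exact (Function.support_sub _ _).trans (Set.union_subset h1 h2)
    · have h4 := hn t
      rw [dist_eq_norm] at h4
      calc ‖(S n - U) t‖ = ‖(Z t - U t) - (Z t - S n t)‖ := by
            rw [SimpleFunc.coe_sub, Pi.sub_apply, sub_sub_sub_cancel_left]
        _ ≤ δ + δ := norm_sub_le_of_le (hUZ t) h4.le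
  rw [simpleOpIntegral_sub hM.1 hB h1 h2] at h3
  have h5 : ‖simpleOpIntegral M (S n)‖ ≤ K' * (δ + δ) + K * (c + δ) := by
    calc ‖simpleOpIntegral M (S n)‖
        = ‖(simpleOpIntegral M (S n) - simpleOpIntegral M U) + simpleOpIntegral M U‖ := by
          rw [sub_add_cancel]
      _ ≤ _ := norm_add_le_of_le h3 hUint
  nlinarith

theorem opTensor_mul_left (x y : 𝒢 →L[ℝ] 𝒢) :
    opTensor (ℋ := ℋ) (x * y) 1 = opTensor x 1 * opTensor y 1 := by
  refine clm_completion_ext fun u => ?_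
  rw [mul_apply_eq_comp, opTensor_coe, opTensor_coe, opTensor_coe,
    ← mul_apply_eq_comp, ← TensorProduct.mapL_mul, one_mul]

theorem opTensor_one : opTensor (1 : 𝒢 →L[ℝ] 𝒢) (1 : ℋ →L[ℝ] ℋ) = 1 := by
  refine clm_completion_ext fun u => ?_
  have h : TensorProduct.mapL (1 : 𝒢 →L[ℝ] 𝒢) (1 : ℋ →L[ℝ] ℋ) = 1 := TensorProduct.mapL_id_id
  rw [opTensor_coe, h]
  rfl

end OpIntegralBounds

section Pairing

variable {T : Type*} [TopologicalSpace T] [MeasurableSpace T] [BorelSpace T]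
  (σ : Measure T) [SFinite σ] [IsFiniteMeasureOnCompacts σ] (lam η : C(T, ℝ))
  {𝒢 : Type*} [NormedAddCommGroup 𝒢] [InnerProductSpace ℝ 𝒢]

/-- The bound for `∫ S ⊗ dM` that comes from the norms of the creation, neutral and annihilation
parts of the process. In contrast to `IsIntegrator`, the constant does not depend on `𝒢`. -/
theorem norm_simpleOpIntegral_processMeasure_le [CompleteSpace 𝒢] {A : Set T}
    (hA : IsBoundedBorel A) {S₀ E L : ℝ≥0} (hS₀ : σ A ≤ S₀) (hE : ∀ t ∈ A, η t ≤ E)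
    (hL : ∀ t ∈ A, |lam t| ≤ L) (S : SimpleFunc T (𝒢 →L[ℝ] 𝒢)) (hS : Function.support S ⊆ A)
    (c : ℝ) (hc0 : 0 ≤ c) (hSc : ∀ t, ‖S t‖ ≤ c) :
    ‖simpleOpIntegral (processMeasure σ lam η) S‖ ≤ (2 * NNReal.sqrt (S₀ + E) + L : ℝ) * c := by
  have e1 := norm_sum_opTensor_le (fun f g h => creation_add σ η)
    (fun f g h => inner_creation_eq_zero σ η h) hA (NNReal.coe_nonneg _)
    (fun B hB hBA => norm_creation_le σ η hA.1 hS₀ hE (indicator_le hB hBA)) hS hc0 hSc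
  have e2 := norm_sum_opTensor_le (fun f g h => neutral_add σ lam η)
    (fun f g h => inner_neutral_eq_zero σ lam η h) hA (NNReal.coe_nonneg _)
    (fun B hB hBA => norm_neutral_le σ lam η hL (indicator_le hB hBA)) hS hc0 hSc
  have : simpleOpIntegral (processMeasure σ lam η) S =
      ∑ x ∈ S.range, opTensor x (setOp (creation σ η) (S ⁻¹' {x}))
      + ∑ x ∈ S.range, opTensor x (setOp (neutral σ lam η) (S ⁻¹' {x}))
      + ∑ x ∈ S.range, opTensor x
          (ContinuousLinearMap.adjoint (setOp (creation σ η) (S ⁻¹' {x}))) := by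
    rw [simpleOpIntegral, ← Finset.sum_add_distrib, ← Finset.sum_add_distrib]
    refine Finset.sum_congr rfl fun x _ => ?_
    rw [processMeasure_eq, opTensor_add_right, opTensor_add_right]
  rw [this]
  refine (norm_add₃_le.trans (add_le_add_three e1.1 e2.1 e1.2)).trans_eq ?_
  push_cast
  ring

theorem pairing_isOpIntegral [CompleteSpace 𝒢] {Z : T → 𝒢 →L[ℝ] 𝒢} (hZ : IsTestOp Z) :
    IsOpIntegral (processMeasure σ lam η) Z (pairing σ lam η Z) := by
  have h := (existsUnique_isOpIntegral σ lam η hZ).exists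
  rw [pairing, opIntegral, dif_pos h]
  exact h.choose_spec

theorem pairing_sub [CompleteSpace 𝒢] {Y Z : T → 𝒢 →L[ℝ] 𝒢} (hY : IsTestOp Y)
    (hZ : IsTestOp Z) (hYZ : IsTestOp fun t => Y t - Z t) :
    pairing σ lam η (fun t => Y t - Z t) = pairing σ lam η Y - pairing σ lam η Z :=
  have hM := isIntegrator_processMeasure σ lam η (𝒢 := 𝒢)
  hM.isOpIntegral_unique (pairing_isOpIntegral σ lam η hYZ)
    (hM.isOpIntegral_sub (pairing_isOpIntegral σ lam η hY) (pairing_isOpIntegral σ lam η hZ))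

theorem pairing_add [CompleteSpace 𝒢] {A : Set T} (hA : IsBoundedBorel A)
    {Y Z : T → 𝒢 →L[ℝ] 𝒢} (hY : IsSimpleLimitOn A Y) (hZ : IsSimpleLimitOn A Z) :
    pairing σ lam η (fun t => Y t + Z t) = pairing σ lam η Y + pairing σ lam η Z := by
  have h := pairing_sub σ lam η ((hY.add hZ).isTestOp hA) (hZ.isTestOp hA)
    (by simpa using hY.isTestOp hA)
  simp only [add_sub_cancel_right] at h
  rw [h, sub_add_cancel]

theorem norm_pairing_le [CompleteSpace 𝒢] {A : Set T}
    (hA : IsBoundedBorel A) {S₀ E L : ℝ≥0} (hS₀ : σ A ≤ S₀) (hE : ∀ t ∈ A, η t ≤ E)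
    (hL : ∀ t ∈ A, |lam t| ≤ L) {Z : T → 𝒢 →L[ℝ] 𝒢} (hZ : IsSimpleLimitOn A Z) {c : ℝ}
    (hc0 : 0 ≤ c) (hc : ∀ t, ‖Z t‖ ≤ c) :
    ‖pairing σ lam η Z‖ ≤ (2 * NNReal.sqrt (S₀ + E) + L : ℝ) * c :=
  (isIntegrator_processMeasure σ lam η).norm_isOpIntegral_le hA (by positivity)
    (norm_simpleOpIntegral_processMeasure_le σ lam η hA hS₀ hE hL) hZ
    (pairing_isOpIntegral σ lam η (hZ.isTestOp hA)) hc0 hc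

theorem norm_leftOp_le (x : 𝒢 →L[ℝ] 𝒢) : ‖leftOp σ η x‖ ≤ ‖x‖ :=
  (norm_opTensor_le _ _).trans (mul_le_of_le_one_right (norm_nonneg _)
    ContinuousLinearMap.norm_id_le)

end Pairing

/-! ### The series `x ^ l / (1 + a x + b x ^ 2)` in a Banach algebra -/

section Ratio

open PowerSeries

theorem coeff_succ_ratioSeries_succ (l : ℕ) (a b : ℝ) (n : ℕ) :
    coeff (n + 1) (ratioSeries (l + 1) a b) = coeff n (ratioSeries l a b) := by
  rw [ratioSeries, pow_succ', mul_assoc, coeff_succ_X_mul, ratioSeries]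

theorem coeff_zero_ratioSeries_succ (l : ℕ) (a b : ℝ) :
    coeff 0 (ratioSeries (l + 1) a b) = 0 := by
  rw [ratioSeries, pow_succ', mul_assoc, coeff_zero_X_mul]

theorem coeff_one_ratioSeries_one (a b : ℝ) : coeff 1 (ratioSeries 1 a b) = 1 := by
  rw [coeff_succ_ratioSeries_succ 0 a b 0, ratioSeries, pow_zero, one_mul,
    coeff_zero_eq_constantCoeff_apply, constantCoeff_inv]
  simp

/-- The coefficients satisfy the linear recursion with characteristic polynomial
`1 + a x + b x ^ 2`. -/
theorem coeff_add_two_ratioSeries_one (a b : ℝ) (n : ℕ) :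
    coeff (n + 2) (ratioSeries 1 a b) =
      -(a * coeff (n + 1) (ratioSeries 1 a b)) - b * coeff n (ratioSeries 1 a b) := by
  have h : (1 + C a * X + C b * X ^ 2) * ratioSeries 1 a b = (X : PowerSeries ℝ) := by
    rw [ratioSeries, mul_left_comm, PowerSeries.mul_inv_cancel _ (by simp), mul_one, pow_one]
  have h1 := congrArg (coeff (n + 2)) h
  have e : (1 + C a * X + C b * X ^ 2) * ratioSeries 1 a b
      = ratioSeries 1 a b + C a * (X * ratioSeries 1 a b)
        + C b * (X * (X * ratioSeries 1 a b)) := by ring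
  rw [e, map_add, map_add, coeff_C_mul, coeff_C_mul, coeff_succ_X_mul, coeff_succ_X_mul,
    coeff_succ_X_mul, coeff_X, if_neg (by omega)] at h1
  linarith

theorem abs_coeff_ratioSeries_one_le (a b : ℝ) (n : ℕ) :
    |coeff n (ratioSeries 1 a b)| ≤ (1 + |a| + |b|) ^ n ∧
      |coeff (n + 1) (ratioSeries 1 a b)| ≤ (1 + |a| + |b|) ^ n := by
  induction n with
  | zero => simp [coeff_one_ratioSeries_one, coeff_zero_ratioSeries_succ 0 a b]
  | succ n ih =>
    have hq : 0 ≤ (1 + |a| + |b|) ^ n := by positivity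
    have hs : (1 + |a| + |b|) ^ (n + 1)
        = (1 + |a| + |b|) ^ n + (|a| * (1 + |a| + |b|) ^ n + |b| * (1 + |a| + |b|) ^ n) := by ring
    have ha := mul_le_mul_of_nonneg_left ih.2 (abs_nonneg a)
    have hb := mul_le_mul_of_nonneg_left ih.1 (abs_nonneg b)
    have := mul_nonneg (abs_nonneg a) hq
    have := mul_nonneg (abs_nonneg b) hq
    refine ⟨by linarith [ih.2], ?_⟩
    rw [coeff_add_two_ratioSeries_one]
    refine (abs_sub _ _).trans ?_
    rw [abs_neg, abs_mul, abs_mul]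
    linarith

theorem continuous_coeff_ratioSeries_one {T : Type*} [TopologicalSpace T] (lam η : C(T, ℝ))
    (n : ℕ) : Continuous (fun t => coeff n (ratioSeries 1 (lam t) (η t))) ∧
      Continuous (fun t => coeff (n + 1) (ratioSeries 1 (lam t) (η t))) := by
  induction n with
  | zero =>
    simp only [coeff_zero_ratioSeries_succ 0, zero_add, coeff_one_ratioSeries_one]
    exact ⟨continuous_const, continuous_const⟩
  | succ n ih =>
    refine ⟨ih.2, ?_⟩
    simp only [coeff_add_two_ratioSeries_one]
    exact ((lam.continuous.mul ih.2).neg).sub (η.continuous.mul ih.1)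

variable {a b : ℝ}

theorem abs_coeff_ratioSeries_one_mul_le {x : ℝ} (hx0 : 0 ≤ x)
    (hx : (1 + |a| + |b|) * x ≤ 1 / 2) (n : ℕ) :
    |coeff (n + 1) (ratioSeries 1 a b)| * x ^ (n + 1) ≤ (1 / 2) ^ n * x := by
  calc |coeff (n + 1) (ratioSeries 1 a b)| * x ^ (n + 1)
      ≤ (1 + |a| + |b|) ^ n * x ^ (n + 1) := by
        gcongr; exact (abs_coeff_ratioSeries_one_le a b n).2
    _ = ((1 + |a| + |b|) * x) ^ n * x := by rw [pow_succ, mul_pow]; ring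
    _ ≤ (1 / 2) ^ n * x := by gcongr

theorem summable_abs_ratioSeries_one {x : ℝ} (hx0 : 0 ≤ x) (hx : (1 + |a| + |b|) * x ≤ 1 / 2) :
    Summable fun n => |coeff n (ratioSeries 1 a b)| * x ^ n :=
  (summable_nat_add_iff 1).1 (Summable.of_nonneg_of_le (fun _ => by positivity)
    (abs_coeff_ratioSeries_one_mul_le hx0 hx) (summable_geometric_two.mul_right x))

theorem summable_abs_ratioSeries_two {x : ℝ} (hx0 : 0 ≤ x) (hx : (1 + |a| + |b|) * x ≤ 1 / 2) :
    Summable fun n => |coeff n (ratioSeries 2 a b)| * x ^ n := by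
  refine (summable_nat_add_iff 1).1
    (((summable_abs_ratioSeries_one hx0 hx).mul_right x).congr fun n => ?_)
  rw [coeff_succ_ratioSeries_succ 1, pow_succ, mul_assoc]

variable {R : Type*} [NormedRing R] [NormedAlgebra ℝ R]

theorem norm_ratioSeries_one_term_le (x : R) (hx : (1 + |a| + |b|) * ‖x‖ ≤ 1 / 2) (n : ℕ) :
    ‖coeff (n + 1) (ratioSeries 1 a b) • x ^ (n + 1)‖ ≤ (1 / 2) ^ n * ‖x‖ := by
  rw [norm_smul, Real.norm_eq_abs]
  exact (mul_le_mul_of_nonneg_left (norm_pow_le' x n.succ_pos) (abs_nonneg _)).trans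
    (abs_coeff_ratioSeries_one_mul_le (norm_nonneg x) hx n)

variable [CompleteSpace R]

theorem summable_ratioSeries_one (x : R) (hx : (1 + |a| + |b|) * ‖x‖ ≤ 1 / 2) :
    Summable fun n => coeff n (ratioSeries 1 a b) • x ^ n :=
  (summable_nat_add_iff 1).1 (Summable.of_norm_bounded (summable_geometric_two.mul_right ‖x‖)
    (norm_ratioSeries_one_term_le x hx))

theorem tsum_ratioSeries_one (x : R) (hx : (1 + |a| + |b|) * ‖x‖ ≤ 1 / 2) :
    ∑' n, coeff n (ratioSeries 1 a b) • x ^ n =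
      ∑' n, coeff (n + 1) (ratioSeries 1 a b) • x ^ (n + 1) := by
  rw [(summable_ratioSeries_one x hx).tsum_eq_zero_add, coeff_zero_ratioSeries_succ 0, zero_smul,
    zero_add]

theorem norm_tsum_ratioSeries_one_le (x : R) (hx : (1 + |a| + |b|) * ‖x‖ ≤ 1 / 2) :
    ‖∑' n, coeff n (ratioSeries 1 a b) • x ^ n‖ ≤ 2 * ‖x‖ := by
  rw [tsum_ratioSeries_one x hx]
  exact tsum_of_norm_bounded (hasSum_geometric_two.mul_right ‖x‖)
    (norm_ratioSeries_one_term_le x hx)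

theorem tsum_ratioSeries_two (x : R) (hx : (1 + |a| + |b|) * ‖x‖ ≤ 1 / 2) :
    ∑' n, coeff n (ratioSeries 2 a b) • x ^ n
      = (∑' n, coeff n (ratioSeries 1 a b) • x ^ n) * x := by
  have h : ∀ n, coeff (n + 1) (ratioSeries 2 a b) • x ^ (n + 1)
      = (coeff n (ratioSeries 1 a b) • x ^ n) * x := fun n => by
    rw [coeff_succ_ratioSeries_succ 1, pow_succ, smul_mul_assoc]
  have hs := (summable_ratioSeries_one x hx).mul_right x
  rw [Summable.tsum_eq_zero_add ((summable_nat_add_iff 1).1 (hs.congr fun n => (h n).symm)),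
    coeff_zero_ratioSeries_succ 1, zero_smul, zero_add, tsum_congr h,
    (summable_ratioSeries_one x hx).tsum_mul_right]

/-- The sum of the Taylor series of `x / (1 + a x + b x ^ 2)`, multiplied by the denominator, is
`x`. -/
theorem tsum_ratioSeries_one_eq (x : R) (hx : (1 + |a| + |b|) * ‖x‖ ≤ 1 / 2) :
    (∑' n, coeff n (ratioSeries 1 a b) • x ^ n)
      + a • ((∑' n, coeff n (ratioSeries 1 a b) • x ^ n) * x)
      + b • ((∑' n, coeff n (ratioSeries 1 a b) • x ^ n) * x * x) = x := by
  have hs := summable_ratioSeries_one x hx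
  set u := ∑' n, coeff n (ratioSeries 1 a b) • x ^ n with hu
  have h1 : u = ∑' n, coeff (n + 1) (ratioSeries 1 a b) • x ^ (n + 1) :=
    tsum_ratioSeries_one x hx
  have hs1 := (summable_nat_add_iff 1).2 hs
  have h2 : u = x + ∑' n, coeff (n + 2) (ratioSeries 1 a b) • x ^ (n + 2) := by
    rw [h1, hs1.tsum_eq_zero_add]
    simp [coeff_one_ratioSeries_one]
  have h3 : ∀ n, coeff (n + 2) (ratioSeries 1 a b) • x ^ (n + 2)
      = -(a • ((coeff (n + 1) (ratioSeries 1 a b) • x ^ (n + 1)) * x))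
        - b • ((coeff n (ratioSeries 1 a b) • x ^ n) * x * x) := fun n => by
    rw [coeff_add_two_ratioSeries_one, sub_smul, neg_smul, mul_smul, mul_smul, smul_mul_assoc,
      smul_mul_assoc, smul_mul_assoc, ← pow_succ, ← pow_succ, ← pow_succ]
  have h4 : ∑' n, coeff (n + 2) (ratioSeries 1 a b) • x ^ (n + 2)
      = -(a • (u * x)) - b • (u * x * x) := by
    rw [tsum_congr h3, Summable.tsum_sub ((hs1.mul_right x).const_smul a).neg
      (((hs.mul_right x).mul_right x).const_smul b), tsum_neg,
      (hs1.mul_right x).tsum_const_smul, ((hs.mul_right x).mul_right x).tsum_const_smul,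
      hs1.tsum_mul_right, (hs.mul_right x).tsum_mul_right, hs.tsum_mul_right, ← h1]
  rw [h4] at h2
  nth_rewrite 1 [h2]
  abel

end Ratio

/-! ### The generating function -/

section Recursion

variable {T : Type*} [TopologicalSpace T] [MeasurableSpace T] [BorelSpace T]
  (σ : Measure T) [SFinite σ] [IsFiniteMeasureOnCompacts σ] (lam η : C(T, ℝ))
  {𝒢 : Type*} [NormedAddCommGroup 𝒢] [InnerProductSpace ℝ 𝒢]

/-- The operator `⟨P⁽ⁿ⁺¹⁾(ω), Y ⊛ Z^{⊛n}⟩`, in which the first argument is free. -/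
noncomputable def headTerm (Z : T → 𝒢 →L[ℝ] 𝒢) (n : ℕ) (Y : T → 𝒢 →L[ℝ] 𝒢) :
    HilbertTensor 𝒢 (ExtFock σ η) →L[ℝ] HilbertTensor 𝒢 (ExtFock σ η) :=
  orthPoly σ lam η (Y :: List.replicate n Z)

variable (Z Y : T → 𝒢 →L[ℝ] 𝒢)

theorem genTerm_zero : genTerm σ lam η Z 0 = 1 := by
  rw [genTerm, List.replicate_zero, orthPoly]

theorem genTerm_succ (n : ℕ) : genTerm σ lam η Z (n + 1) = headTerm σ lam η Z n Z := by
  rw [genTerm, List.replicate_succ, headTerm]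

theorem headTerm_zero : headTerm σ lam η Z 0 Y = pairing σ lam η Y := by
  rw [headTerm, List.replicate_zero, orthPoly]

theorem headTerm_one : headTerm σ lam η Z 1 Y =
    pairing σ lam η Y * genTerm σ lam η Z 1
      - headTerm σ lam η Z 0 (fun t => lam t • (Y t * Z t))
      - leftOp σ η (∫ t, Y t * Z t ∂σ) * genTerm σ lam η Z 0 := by
  rw [headTerm, List.replicate_one, orthPoly, headTerm, List.replicate_zero, genTerm,
    List.replicate_one, genTerm, List.replicate_zero]

theorem headTerm_add_two (n : ℕ) : headTerm σ lam η Z (n + 2) Y =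
    pairing σ lam η Y * genTerm σ lam η Z (n + 2)
      - headTerm σ lam η Z (n + 1) (fun t => lam t • (Y t * Z t))
      - leftOp σ η (∫ t, Y t * Z t ∂σ) * genTerm σ lam η Z (n + 1)
      - headTerm σ lam η Z n (fun t => η t • (Y t * Z t * Z t)) := by
  rw [headTerm, List.replicate_succ, List.replicate_succ, orthPoly]
  rfl

theorem leftOp_add (x y : 𝒢 →L[ℝ] 𝒢) : leftOp σ η (x + y) = leftOp σ η x + leftOp σ η y :=
  opTensor_add_left x y 1

theorem leftOp_mul (x y : 𝒢 →L[ℝ] 𝒢) : leftOp σ η (x * y) = leftOp σ η x * leftOp σ η y :=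
  opTensor_mul_left x y

theorem leftOp_one : leftOp σ η (1 : 𝒢 →L[ℝ] 𝒢) = 1 := opTensor_one

variable {Z} {A : Set T}

theorem headTerm_add [CompleteSpace 𝒢] (hA : IsBoundedBorel A) (hZ : IsSimpleLimitOn A Z) (n : ℕ) :
    ∀ {Y Y' : T → 𝒢 →L[ℝ] 𝒢}, IsSimpleLimitOn A Y → IsSimpleLimitOn A Y' →
      headTerm σ lam η Z n (fun t => Y t + Y' t)
        = headTerm σ lam η Z n Y + headTerm σ lam η Z n Y' := by
  have hI : ∀ {Y Y' : T → 𝒢 →L[ℝ] 𝒢}, IsSimpleLimitOn A Y → IsSimpleLimitOn A Y' →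
      leftOp σ η (∫ t, (Y t + Y' t) * Z t ∂σ)
        = leftOp σ η (∫ t, Y t * Z t ∂σ) + leftOp σ η (∫ t, Y' t * Z t ∂σ) := by
    intro Y Y' hY hY'
    simp only [add_mul]
    rw [integral_add ((hY.mul hZ).integrable hA) ((hY'.mul hZ).integrable hA), leftOp_add]
  induction n using Nat.twoStepInduction with
  | zero =>
    intro Y Y' hY hY'
    simp only [headTerm_zero]
    exact pairing_add σ lam η hA hY hY'
  | one =>
    intro Y Y' hY hY'
    have h1 := (hY.mul hZ).continuous_smul lam.continuous hA
    have h2 := (hY'.mul hZ).continuous_smul lam.continuous hA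
    rw [headTerm_one, headTerm_one, headTerm_one, pairing_add σ lam η hA hY hY', hI hY hY']
    simp only [headTerm_zero, add_mul, smul_add]
    rw [pairing_add σ lam η hA h1 h2]
    abel
  | more n ih0 ih1 =>
    intro Y Y' hY hY'
    have h1 := (hY.mul hZ).continuous_smul lam.continuous hA
    have h2 := (hY'.mul hZ).continuous_smul lam.continuous hA
    have h3 := ((hY.mul hZ).mul hZ).continuous_smul η.continuous hA
    have h4 := ((hY'.mul hZ).mul hZ).continuous_smul η.continuous hA
    rw [headTerm_add_two, headTerm_add_two, headTerm_add_two, pairing_add σ lam η hA hY hY',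
      hI hY hY']
    simp only [add_mul, smul_add]
    rw [ih1 h1 h2, ih0 h3 h4]
    abel

end Recursion

/-- The recursion `q_{n+2} = w p_{n+2} - q'_{n+1} - v p_{n+1} - q''_n`, with the initial values
that drop the terms of negative index, summed over `n`. -/
theorem tsum_recursion {R : Type*} [NormedRing R] {q q' q'' p : ℕ → R} {w v : R}
    (sq : Summable q) (sq' : Summable q') (sq'' : Summable q'') (sp : Summable p)
    (h0 : q 0 = w) (hp : p 0 = 1) (h1 : q 1 = w * p 1 - q' 0 - v * p 0)
    (h2 : ∀ n, q (n + 2) = w * p (n + 2) - q' (n + 1) - v * p (n + 1) - q'' n) :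
    ∑' n, q n + ∑' n, q' n + ∑' n, q'' n = (w - v) * ∑' n, p n := by
  have sp1 := (summable_nat_add_iff 1).2 sp
  have sp2 := (summable_nat_add_iff 2).2 sp
  have sq'1 := (summable_nat_add_iff 1).2 sq'
  have e1 : ∑' n, q (n + 2) = w * ∑' n, p (n + 2) - ∑' n, q' (n + 1) - v * ∑' n, p (n + 1)
      - ∑' n, q'' n := by
    rw [tsum_congr h2,
      Summable.tsum_sub (((sp2.mul_left w).sub sq'1).sub (sp1.mul_left v)) sq'',
      Summable.tsum_sub ((sp2.mul_left w).sub sq'1) (sp1.mul_left v),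
      Summable.tsum_sub (sp2.mul_left w) sq'1, sp2.tsum_mul_left, sp1.tsum_mul_left]
  have e0 : ∑' n, q n = w + (q 1 + ∑' n, q (n + 2)) := by
    rw [sq.tsum_eq_zero_add, ((summable_nat_add_iff 1).2 sq).tsum_eq_zero_add, h0]
  have p1 : ∑' n, p n = 1 + ∑' n, p (n + 1) := by rw [sp.tsum_eq_zero_add, hp]
  have p2 : ∑' n, p n = 1 + (p 1 + ∑' n, p (n + 2)) := by rw [p1, sp1.tsum_eq_zero_add]
  have hw : w * ∑' n, p n = w * (1 + (p 1 + ∑' n, p (n + 2))) := by rw [← p2]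
  rw [e0, e1, h1, sq'.tsum_eq_zero_add, hp, sub_mul, hw, p1]
  simp only [mul_add, mul_one]
  abel

section Bounds

variable {T : Type*} [TopologicalSpace T] [MeasurableSpace T] [BorelSpace T]

/-- `A ∈ 𝓑₀(T)`, and `S`, `E`, `L` are bounds for `σ(A)` and for `|η|` and `|λ|` on `A`. -/
structure HasBoundsOn (σ : Measure T) (lam η : C(T, ℝ)) (A : Set T) (S E L : ℝ≥0) : Prop where
  isBoundedBorel : IsBoundedBorel A
  measure_le : σ A ≤ S
  abs_eta_le : ∀ t ∈ A, |η t| ≤ E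
  abs_lam_le : ∀ t ∈ A, |lam t| ≤ L

/-- The constant `D = K + L + S + E + 1`, where `K = 2 √(S + E) + L` is the bound for `Z ↦ ⟨ω, Z⟩`
on mappings that vanish outside `A`. It dominates the coefficients in the recursion of the
polynomials, and the summand `1` makes it positive. -/
noncomputable def growthConst (S E L : ℝ≥0) : ℝ := (2 * NNReal.sqrt (S + E) + L) + L + S + E + 1

theorem one_le_growthConst (S E L : ℝ≥0) : 1 ≤ growthConst S E L := by
  have : (0 : ℝ) ≤ 2 * NNReal.sqrt (S + E) + L + L + S + E := by positivity
  rw [growthConst]; linarith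

variable {σ : Measure T} [SFinite σ] [IsFiniteMeasureOnCompacts σ] {lam η : C(T, ℝ)}
  {𝒢 : Type*} [NormedAddCommGroup 𝒢] [InnerProductSpace ℝ 𝒢]
  {A : Set T} {S E L : ℝ≥0}

theorem IsSimpleLimitOn.norm_smul_le {φ : T → ℝ} {C : ℝ≥0} (hφ : ∀ t ∈ A, |φ t| ≤ C)
    {f : T → 𝒢 →L[ℝ] 𝒢} (hf : IsSimpleLimitOn A f) {c : ℝ} (hc0 : 0 ≤ c)
    (hc : ∀ t, ‖f t‖ ≤ c) (t : T) : ‖φ t • f t‖ ≤ C * c := by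
  by_cases ht : t ∈ A
  · rw [norm_smul]
    exact mul_le_mul (hφ t ht) (hc t) (norm_nonneg _) C.coe_nonneg
  · rw [hf.eq_zero ht, smul_zero, norm_zero]
    positivity

variable [CompleteSpace 𝒢]

theorem HasBoundsOn.norm_pairing_le (h : HasBoundsOn σ lam η A S E L) {Y : T → 𝒢 →L[ℝ] 𝒢}
    (hY : IsSimpleLimitOn A Y) {y : ℝ} (hy0 : 0 ≤ y) (hy : ∀ t, ‖Y t‖ ≤ y) :
    ‖pairing σ lam η Y‖ ≤ (2 * NNReal.sqrt (S + E) + L : ℝ) * y :=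
  FreeMeixner.norm_pairing_le σ lam η h.isBoundedBorel h.measure_le
    (fun t ht => (le_abs_self _).trans (h.abs_eta_le t ht)) h.abs_lam_le hY hy0 hy

theorem HasBoundsOn.norm_leftOp_integral_le (h : HasBoundsOn σ lam η A S E L)
    {Y : T → 𝒢 →L[ℝ] 𝒢} (hY : IsSimpleLimitOn A Y) {y : ℝ} (hy0 : 0 ≤ y)
    (hy : ∀ t, ‖Y t‖ ≤ y) : ‖leftOp σ η (∫ t, Y t ∂σ)‖ ≤ S * y :=
  (norm_leftOp_le σ η _).trans (hY.norm_integral_le h.measure_le hy hy0)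

/-- Geometric growth of `⟨P⁽ⁿ⁺¹⁾(ω), Y ⊛ Z^{⊛n}⟩`. The ratio `2 D ‖Z‖_∞` is chosen so that the
induction closes: it reduces to `2 D (K + L) + S + E ≤ 4 D²`. -/
theorem HasBoundsOn.norm_headTerm_le (h : HasBoundsOn σ lam η A S E L) {Z : T → 𝒢 →L[ℝ] 𝒢}
    (hZ : IsSimpleLimitOn A Z) {z : ℝ} (hz0 : 0 ≤ z) (hz : ∀ t, ‖Z t‖ ≤ z) (n : ℕ) :
    ∀ {Y : T → 𝒢 →L[ℝ] 𝒢}, IsSimpleLimitOn A Y → ∀ {y : ℝ}, 0 ≤ y → (∀ t, ‖Y t‖ ≤ y) →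
      ‖headTerm σ lam η Z n Y‖
        ≤ y * (growthConst S E L * (2 * growthConst S E L * z) ^ n) := by
  have hA := h.isBoundedBorel
  set K : ℝ := 2 * NNReal.sqrt (S + E) + L with hK
  have hK0 : 0 ≤ K := by positivity
  have hD : growthConst S E L = K + L + S + E + 1 := rfl
  set D := growthConst S E L
  have hL0 : (0 : ℝ) ≤ L := L.coe_nonneg
  have hS0 : (0 : ℝ) ≤ S := S.coe_nonneg
  have hE0 : (0 : ℝ) ≤ E := E.coe_nonneg
  have hD1 : 1 ≤ D := one_le_growthConst S E L
  induction n using Nat.twoStepInduction with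
  | zero =>
    intro Y hY y hy0 hy
    rw [headTerm_zero]
    have := h.norm_pairing_le hY hy0 hy
    nlinarith
  | one =>
    intro Y hY y hy0 hy
    have hYZ := hY.mul hZ
    have hyz : ∀ t, ‖Y t * Z t‖ ≤ y * z := fun t => norm_mul_le_of_le (hy t) (hz t)
    have hyz0 : 0 ≤ y * z := mul_nonneg hy0 hz0
    have b1 := h.norm_pairing_le hY hy0 hy
    have b2 := h.norm_pairing_le hZ hz0 hz
    have b3 := h.norm_pairing_le (hYZ.continuous_smul lam.continuous hA)
      (mul_nonneg hL0 hyz0) (hYZ.norm_smul_le h.abs_lam_le hyz0 hyz)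
    have b4 := h.norm_leftOp_integral_le hYZ hyz0 hyz
    rw [headTerm_one, genTerm_succ, headTerm_zero, headTerm_zero, genTerm_zero, mul_one]
    have b5 := norm_sub_le_of_le (norm_sub_le_of_le (norm_mul_le_of_le b1 b2) b3) b4
    refine b5.trans ?_
    have : K * y * (K * z) + K * (L * (y * z)) + S * (y * z)
        = y * z * (K * K + K * L + S) := by ring
    rw [this, pow_one]
    have : y * (D * (2 * D * z)) = y * z * (2 * D * D) := by ring
    rw [this]
    refine mul_le_mul_of_nonneg_left ?_ hyz0
    have : K * (K + L) ≤ D * D := by gcongr <;> linarith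
    nlinarith
  | more n ih0 ih1 =>
    intro Y hY y hy0 hy
    have hYZ := hY.mul hZ
    have hyz : ∀ t, ‖Y t * Z t‖ ≤ y * z := fun t => norm_mul_le_of_le (hy t) (hz t)
    have hyz0 : 0 ≤ y * z := mul_nonneg hy0 hz0
    have hYZZ := hYZ.mul hZ
    have hyzz : ∀ t, ‖Y t * Z t * Z t‖ ≤ y * z * z := fun t => norm_mul_le_of_le (hyz t) (hz t)
    have hyzz0 : 0 ≤ y * z * z := mul_nonneg hyz0 hz0
    have b1 := h.norm_pairing_le hY hy0 hy
    have b2 := ih1 hZ hz0 hz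
    have b3 := ih1 (hYZ.continuous_smul lam.continuous hA)
      (mul_nonneg hL0 hyz0) (hYZ.norm_smul_le h.abs_lam_le hyz0 hyz)
    have b4 := h.norm_leftOp_integral_le hYZ hyz0 hyz
    have b5 := ih0 hZ hz0 hz
    have b6 := ih0 (hYZZ.continuous_smul η.continuous hA)
      (mul_nonneg hE0 hyzz0) (hYZZ.norm_smul_le h.abs_eta_le hyzz0 hyzz)
    rw [headTerm_add_two, genTerm_succ, genTerm_succ]
    have b7 := norm_sub_le_of_le (norm_sub_le_of_le (norm_sub_le_of_le
      (norm_mul_le_of_le b1 b2) b3) (norm_mul_le_of_le b4 b5)) b6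
    refine b7.trans ?_
    set ρ := 2 * D * z with hρ
    have hρ0 : 0 ≤ ρ := by positivity
    have e1 : K * y * (z * (D * ρ ^ (n + 1))) + L * (y * z) * (D * ρ ^ (n + 1))
        + S * (y * z) * (z * (D * ρ ^ n)) + E * (y * z * z) * (D * ρ ^ n)
        = y * z * z * D * ρ ^ n * (2 * D * (K + L) + (S + E)) := by
      rw [pow_succ]; nth_rewrite 2 [hρ]; nth_rewrite 3 [hρ]; ring
    have e2 : y * (D * ρ ^ (n + 2)) = y * z * z * D * ρ ^ n * (4 * D * D) := by
      rw [pow_add ρ n 2]; nth_rewrite 2 [hρ]; ring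
    rw [e1, e2]
    refine mul_le_mul_of_nonneg_left ?_ (by positivity)
    have : D * (K + L) ≤ D * D := by gcongr; linarith
    nlinarith

variable {Z : T → 𝒢 →L[ℝ] 𝒢}

theorem HasBoundsOn.summable_norm_headTerm (h : HasBoundsOn σ lam η A S E L)
    (hZ : IsSimpleLimitOn A Z) {z : ℝ} (hz0 : 0 ≤ z) (hz : ∀ t, ‖Z t‖ ≤ z)
    (hsmall : 4 * growthConst S E L * z ≤ 1) {Y : T → 𝒢 →L[ℝ] 𝒢} (hY : IsSimpleLimitOn A Y) :
    Summable fun n => ‖headTerm σ lam η Z n Y‖ := by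
  obtain ⟨y, hy0, hy⟩ := hY.exists_bound
  have hD := one_le_growthConst S E L
  refine Summable.of_nonneg_of_le (fun _ => norm_nonneg _)
    (fun n => h.norm_headTerm_le hZ hz0 hz n hY hy0 hy) (Summable.mul_left y
      (Summable.mul_left _ (summable_geometric_of_lt_one (by positivity) ?_)))
  linarith

theorem HasBoundsOn.summable_norm_genTerm (h : HasBoundsOn σ lam η A S E L)
    (hZ : IsSimpleLimitOn A Z) {z : ℝ} (hz0 : 0 ≤ z) (hz : ∀ t, ‖Z t‖ ≤ z)
    (hsmall : 4 * growthConst S E L * z ≤ 1) :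
    Summable fun n => ‖genTerm σ lam η Z n‖ :=
  (summable_nat_add_iff 1).1 ((h.summable_norm_headTerm hZ hz0 hz hsmall hZ).congr fun n => by
    rw [genTerm_succ])

/-- Summation of the recursion over `n`: with `G(Y) = ∑ₙ ⟨P⁽ⁿ⁺¹⁾(ω), Y ⊛ Z^{⊛n}⟩`, one has
`G(Y (1 + λ Z + η Z²)) = (⟨ω, Y⟩ - ∫ Y Z dσ) G(Z, ω)`. -/
theorem HasBoundsOn.tsum_headTerm_eq (h : HasBoundsOn σ lam η A S E L)
    (hZ : IsSimpleLimitOn A Z) {z : ℝ} (hz0 : 0 ≤ z) (hz : ∀ t, ‖Z t‖ ≤ z)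
    (hsmall : 4 * growthConst S E L * z ≤ 1) {Y : T → 𝒢 →L[ℝ] 𝒢} (hY : IsSimpleLimitOn A Y) :
    ∑' n, headTerm σ lam η Z n
        (fun t => Y t + lam t • (Y t * Z t) + η t • (Y t * Z t * Z t))
      = (pairing σ lam η Y - leftOp σ η (∫ t, Y t * Z t ∂σ)) * genFun σ lam η Z := by
  have hA := h.isBoundedBorel
  have h1 := (hY.mul hZ).continuous_smul lam.continuous hA
  have h2 := ((hY.mul hZ).mul hZ).continuous_smul η.continuous hA
  have sum : ∀ {Y : T → 𝒢 →L[ℝ] 𝒢}, IsSimpleLimitOn A Y →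
      Summable fun n => headTerm σ lam η Z n Y := fun hY =>
    (h.summable_norm_headTerm hZ hz0 hz hsmall hY).of_norm
  have s0 := sum hY
  have s1 := sum h1
  have s2 := sum h2
  have sg : Summable fun n => genTerm σ lam η Z n :=
    (h.summable_norm_genTerm hZ hz0 hz hsmall).of_norm
  simp only [headTerm_add σ lam η hA hZ _ (hY.add h1) h2, headTerm_add σ lam η hA hZ _ hY h1]
  rw [(s0.add s1).tsum_add s2, s0.tsum_add s1]
  exact tsum_recursion s0 s1 s2 sg (headTerm_zero σ lam η Z Y) (genTerm_zero σ lam η Z)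
    (headTerm_one σ lam η Z Y) (headTerm_add_two σ lam η Z Y)

end Bounds

/-! ### The resolvent formula -/

section Resolvent

variable {T : Type*} [TopologicalSpace T] [MeasurableSpace T] [BorelSpace T]
  {σ : Measure T} [SFinite σ] [IsFiniteMeasureOnCompacts σ] {lam η : C(T, ℝ)}
  {𝒢 : Type*} [NormedAddCommGroup 𝒢] [InnerProductSpace ℝ 𝒢] [CompleteSpace 𝒢]
  {A : Set T} {S E L : ℝ≥0} {Z : T → 𝒢 →L[ℝ] 𝒢} {z : ℝ}

/-- The smallness condition under which the series of `Z ^ l / (1 + λ Z + η Z ^ 2)` converge. It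
holds outside `A` too, since `Z` vanishes there. -/
theorem HasBoundsOn.ratio_small (h : HasBoundsOn σ lam η A S E L) (hZ : IsSimpleLimitOn A Z)
    (hz : ∀ t, ‖Z t‖ ≤ z) (hsmall : 4 * growthConst S E L * z ≤ 1) (t : T) :
    (1 + |lam t| + |η t|) * ‖Z t‖ ≤ 1 / 2 := by
  by_cases ht : t ∈ A
  · have : (0 : ℝ) ≤ 2 * NNReal.sqrt (S + E) + L + S := by positivity
    have h1 : 1 + |lam t| + |η t| ≤ growthConst S E L := by
      have := h.abs_lam_le t ht
      have := h.abs_eta_le t ht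
      rw [growthConst]; linarith
    have h2 : (1 + |lam t| + |η t|) * ‖Z t‖ ≤ growthConst S E L * z :=
      mul_le_mul h1 (hz t) (norm_nonneg _) (by linarith [one_le_growthConst S E L])
    linarith
  · rw [hZ.eq_zero ht, norm_zero, mul_zero]
    norm_num

theorem HasBoundsOn.isSimpleLimitOn_ratioOp_one (h : HasBoundsOn σ lam η A S E L)
    (hZ : IsSimpleLimitOn A Z) (hz : ∀ t, ‖Z t‖ ≤ z)
    (hr : ∀ t, (1 + |lam t| + |η t|) * ‖Z t‖ ≤ 1 / 2) :
    IsSimpleLimitOn A (ratioOp lam η 1 Z) := by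
  have hpow : ∀ n, IsSimpleLimitOn A (fun t => Z t ^ (n + 1)) := fun n => by
    induction n with
    | zero => simpa using hZ
    | succ n ih => simpa only [pow_succ _ (n + 1)] using ih.mul hZ
  have hlim := tendstoUniformly_tsum_nat (summable_geometric_two.mul_right z)
    (f := fun n t => PowerSeries.coeff (n + 1) (ratioSeries 1 (lam t) (η t)) • Z t ^ (n + 1))
    fun n t => (norm_ratioSeries_one_term_le (Z t) (hr t) n).trans
      (mul_le_mul_of_nonneg_left (hz t) (by positivity))
  have heq : ratioOp lam η 1 Z = fun t => ∑' n,
      PowerSeries.coeff (n + 1) (ratioSeries 1 (lam t) (η t)) • Z t ^ (n + 1) :=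
    funext fun t => tsum_ratioSeries_one (Z t) (hr t)
  rw [heq]
  exact .of_tendstoUniformly (fun N => .sum fun n _ =>
    (hpow n).continuous_smul (continuous_coeff_ratioSeries_one lam η n).2 h.isBoundedBorel) hlim

theorem ratioOp_two_eq (hr : ∀ t, (1 + |lam t| + |η t|) * ‖Z t‖ ≤ 1 / 2) :
    ratioOp lam η 2 Z = fun t => ratioOp lam η 1 Z t * Z t :=
  funext fun t => tsum_ratioSeries_two (Z t) (hr t)

/-- `(1 - ⟨ω, Ψ⟩ + ∫ Ψ Z dσ) G(Z, ω) = 1` for `Ψ = Z / (1 + λ Z + η Z ^ 2)`. -/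
theorem HasBoundsOn.resolvent_mul_genFun (h : HasBoundsOn σ lam η A S E L)
    (hZ : IsSimpleLimitOn A Z) (hz0 : 0 ≤ z) (hz : ∀ t, ‖Z t‖ ≤ z)
    (hsmall : 4 * growthConst S E L * z ≤ 1) :
    (1 - pairing σ lam η (ratioOp lam η 1 Z) + leftOp σ η (∫ t, ratioOp lam η 2 Z t ∂σ))
      * genFun σ lam η Z = 1 := by
  have hr := h.ratio_small hZ hz hsmall
  have hΨ := h.isSimpleLimitOn_ratioOp_one hZ hz hr
  have key := h.tsum_headTerm_eq hZ hz0 hz hsmall hΨ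
  have hZeq : (fun t => ratioOp lam η 1 Z t + lam t • (ratioOp lam η 1 Z t * Z t)
      + η t • (ratioOp lam η 1 Z t * Z t * Z t)) = Z :=
    funext fun t => tsum_ratioSeries_one_eq (Z t) (hr t)
  have hG : genFun σ lam η Z = 1 + ∑' n, headTerm σ lam η Z n Z := by
    rw [genFun, (h.summable_norm_genTerm hZ hz0 hz hsmall).of_norm.tsum_eq_zero_add, genTerm_zero]
    simp only [genTerm_succ]
  rw [hZeq, sub_mul] at key
  rw [ratioOp_two_eq hr, add_mul, sub_mul, one_mul]
  have e : genFun σ lam η Z - ∑' n, headTerm σ lam η Z n Z = 1 := by rw [hG]; abel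
  rw [key] at e
  rw [← e]
  abel

theorem norm_ratioOp_two_le (hz : ∀ t, ‖Z t‖ ≤ z)
    (hr : ∀ t, (1 + |lam t| + |η t|) * ‖Z t‖ ≤ 1 / 2) (t : T) :
    ‖ratioOp lam η 2 Z t‖ ≤ 2 * z * z := by
  rw [ratioOp_two_eq hr]
  exact norm_mul_le_of_le ((norm_tsum_ratioSeries_one_le (Z t) (hr t)).trans
    (mul_le_mul_of_nonneg_left (hz t) zero_le_two)) (hz t)

end Resolvent

end FreeMeixner

theorem theorem3p1 {T : Type*} [TopologicalSpace T] [PolishSpace T] [LocallyCompactSpace T]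
    [MeasurableSpace T] [BorelSpace T]
    (σ : Measure T) [IsLocallyFiniteMeasure σ] [NullSingletonClass σ] [σ.IsOpenPosMeasure]
    (lam η : C(T, ℝ)) (hη : ∀ t, 0 ≤ η t)
    (A : Set T) (hA : IsBoundedBorel A) :
    ∃ C₅ : ℝ, 0 < C₅ ∧
      ∀ (𝒢 : Type*) [NormedAddCommGroup 𝒢] [InnerProductSpace ℝ 𝒢] [CompleteSpace 𝒢]
        (Z : T → 𝒢 →L[ℝ] 𝒢), IsTestOp Z → Function.support Z ⊆ A → opSupNorm Z < C₅ →
        -- the quotients `Z ^ l / (1 + λ Z + η Z ^ 2)`, `l = 1, 2`, are given by power series that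
        -- converge absolutely, and they belong to `𝒵(T)`
        (∀ l ∈ ({1, 2} : Set ℕ),
          (∀ t, Summable fun n => |PowerSeries.coeff n (ratioSeries l (lam t) (η t))| * ‖Z t‖ ^ n) ∧
          IsTestOp (ratioOp lam η l Z)) ∧
        -- the series for `G(Z, ω)` converges absolutely
        (Summable fun n => ‖genTerm σ lam η Z n‖) ∧
        -- the resolvent formula
        IsUnit (1 - pairing σ lam η (ratioOp lam η 1 Z)
          + leftOp σ η (∫ t, ratioOp lam η 2 Z t ∂σ)) ∧
        genFun σ lam η Z =
          Ring.inverse (1 - pairing σ lam η (ratioOp lam η 1 Z)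
            + leftOp σ η (∫ t, ratioOp lam η 2 Z t ∂σ)) ∧
        -- the second form, with `f = (1 + ∫ Z ^ 2 / (1 + λ Z + η Z ^ 2) dσ)⁻¹`
        IsUnit (1 + ∫ t, ratioOp lam η 2 Z t ∂σ) ∧
        ∀ f : 𝒢 →L[ℝ] 𝒢, f = Ring.inverse (1 + ∫ t, ratioOp lam η 2 Z t ∂σ) →
          IsUnit (1 - leftOp σ η f * pairing σ lam η (ratioOp lam η 1 Z)) ∧
          genFun σ lam η Z =
            Ring.inverse (1 - leftOp σ η f * pairing σ lam η (ratioOp lam η 1 Z))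
              * leftOp σ η f := by
  obtain ⟨S, _, L, hS, -, hL⟩ := exists_bounds σ lam η hA
  obtain ⟨-, -, E, -, -, hE⟩ := exists_bounds σ η η hA
  have h : HasBoundsOn σ lam η A S E L := ⟨hA, hS, hE, hL⟩
  have hD1 := one_le_growthConst S E L
  have hD : growthConst S E L = (2 * NNReal.sqrt (S + E) + L : ℝ) + L + S + E + 1 := rfl
  set D := growthConst S E L
  refine ⟨1 / (4 * D), by positivity, fun 𝒢 _ _ _ Z hZt hsupp hlt => ?_⟩
  have hZ := hZt.isSimpleLimitOn hA.1 hsupp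
  have hz := norm_le_opSupNorm hZ
  have hz0 : 0 ≤ opSupNorm Z := Real.iSup_nonneg fun t => norm_nonneg _
  set z := opSupNorm Z
  have hzD : z * (4 * D) < 1 := (lt_div_iff₀ (by positivity)).1 hlt
  have hsmall : 4 * D * z ≤ 1 := by linarith
  have hr := h.ratio_small hZ hz hsmall
  have hΨ := h.isSimpleLimitOn_ratioOp_one hZ hz hr
  have hΨ2 : IsSimpleLimitOn A (ratioOp lam η 2 Z) := by
    rw [ratioOp_two_eq hr]; exact hΨ.mul hZ
  have hΨn : ∀ t, ‖ratioOp lam η 1 Z t‖ ≤ 2 * z := fun t =>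
    (norm_tsum_ratioSeries_one_le (Z t) (hr t)).trans
      (mul_le_mul_of_nonneg_left (hz t) zero_le_two)
  have hW := h.norm_pairing_le hΨ (by positivity) hΨn
  have hJ := hΨ2.norm_integral_le hS (norm_ratioOp_two_le hz hr) (by positivity)
  have hJ' := (norm_leftOp_le σ η _).trans hJ
  have hmul := h.resolvent_mul_genFun hZ hz0 hz hsmall
  set W := pairing σ lam η (ratioOp lam η 1 Z)
  set J := ∫ t, ratioOp lam η 2 Z t ∂σ
  -- `‖W‖ + ‖J‖ ≤ 2 K z + 2 S z² < 1`, so both operators are invertible by Neumann series.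
  have hK0 : (0 : ℝ) ≤ 2 * NNReal.sqrt (S + E) + L := by positivity
  have hL0 : (0 : ℝ) ≤ L := L.coe_nonneg
  have hS0 : (0 : ℝ) ≤ S := S.coe_nonneg
  have hE0 : (0 : ℝ) ≤ E := E.coe_nonneg
  have hz1 : z ≤ 1 := by nlinarith
  have hSz : (S : ℝ) * (2 * z * z) ≤ S * (2 * z) :=
    mul_le_mul_of_nonneg_left (by nlinarith) hS0
  have hsum : (2 * NNReal.sqrt (S + E) + L : ℝ) * (2 * z) + S * (2 * z) < 1 := by
    nlinarith
  have hWz : 0 ≤ (2 * NNReal.sqrt (S + E) + L : ℝ) * (2 * z) := by positivity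
  have hR : IsUnit (1 - W + leftOp σ η J) := by
    have : 1 - W + leftOp σ η J = 1 - (W - leftOp σ η J) := by abel
    rw [this]
    refine isUnit_one_sub_of_norm_lt_one ((norm_sub_le_of_le hW hJ').trans_lt ?_)
    linarith
  have hF : IsUnit (1 + J) := by
    rw [← sub_neg_eq_add]
    refine isUnit_one_sub_of_norm_lt_one ?_
    rw [norm_neg]
    linarith
  have hG : genFun σ lam η Z = Ring.inverse (1 - W + leftOp σ η J) := by
    rw [← mul_one (Ring.inverse _), eq_comm, Ring.inverse_mul_eq_iff_eq_mul _ _ _ hR, hmul]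
  refine ⟨?_, h.summable_norm_genTerm hZ hz0 hz hsmall, hR, hG, hF, ?_⟩
  · rintro l (rfl | rfl)
    · exact ⟨fun t => summable_abs_ratioSeries_one (norm_nonneg _) (hr t), hΨ.isTestOp hA⟩
    · exact ⟨fun t => summable_abs_ratioSeries_two (norm_nonneg _) (hr t), hΨ2.isTestOp hA⟩
  · rintro f rfl
    have hf : IsUnit (leftOp σ η (Ring.inverse (1 + J))) := by
      refine ⟨⟨leftOp σ η (Ring.inverse (1 + J)), leftOp σ η (1 + J), ?_, ?_⟩, rfl⟩
      · rw [← leftOp_mul, Ring.inverse_mul_cancel _ hF, leftOp_one]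
      · rw [← leftOp_mul, Ring.mul_inverse_cancel _ hF, leftOp_one]
    -- `1 - f W = f (f⁻¹ - W)` with `f⁻¹ = 1 + J`.
    have hfac : 1 - leftOp σ η (Ring.inverse (1 + J)) * W
        = leftOp σ η (Ring.inverse (1 + J)) * (1 - W + leftOp σ η J) := by
      have h1 : leftOp σ η (Ring.inverse (1 + J)) * (1 + leftOp σ η J) = 1 := by
        rw [← leftOp_one, ← leftOp_add, ← leftOp_mul, Ring.inverse_mul_cancel _ hF]
      rw [sub_add_eq_add_sub, mul_sub, h1]
    have hU := hf.mul hR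
    rw [← hfac] at hU
    have h2 : (1 - leftOp σ η (Ring.inverse (1 + J)) * W) * genFun σ lam η Z
        = leftOp σ η (Ring.inverse (1 + J)) := by
      rw [hfac, mul_assoc, hmul, mul_one]
    exact ⟨hU, ((Ring.inverse_mul_eq_iff_eq_mul _ _ _ hU).2 h2.symm).symm⟩
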